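/- Let $k=\mathbb R$ or $k=\mathbb C$, and let $I=[0,1]$. A locally convex $k$-algebra is an associative, not necessarily unital, $k$-algebra $A$ with a complete Hausdorff locally convex topology for which the multiplication $A\times A\to A$ is jointly continuous. For a compact space $X$ let $A^X$ be the algebra of continuous maps $X\to A$ with the topology of uniform convergence, and let $A^{\infty(I)}$ be the algebra of maps $I\to A$ that have derivatives of all orders, with the topology of uniform convergence of all derivatives. Let $\mathcal I(A)\subset A^{\infty(I)}$ and $\mathcal J(A)\subset A^{I}$ be the ideals of the paths $f$ with $f(0)=0$, and let $\tau\colon\mathcal I(A)\to A$ and $\tau\colon\mathcal J(A)\to A$ be $f\mapsto f(1)$. For $\mathcal P=\mathcal I$ or $\mathcal P=\mathcal J$ put $\mathcal P_{-1}(A)=A$ and $\mathcal P_n(A)=\mathcal P^{\,n+1}(A)$ for $n\ge 0$, with face maps $\delta_m=\mathcal P^m\tau\,\mathcal P^{\,n-m}\colon\mathcal P_n(A)\to\mathcal P_{n-1}(A)$, $0\le m\le n$; this is the augmented simplicial algebra $\mathcal P^+_*(A)$ of the path cotriple $\mathcal P$. Let $A^+=A\oplus k$ be the algebra obtained by adjoining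 a unit to $A$, let $GL_m(A)=\ker(GL_m(A^+)\to GL_m(k))$, and let $GL(A)=\varinjlim_m GL_m(A)$. For $n\ge 1$ define $$K^{sm}_n(A)=\pi_{n-2}\,GL(\mathcal I^+_*(A)),\qquad K^{top}_n(A)=\pi_{n-2}\,GL(\mathcal J^+_*(A)),$$ the homotopy groups of augmented simplicial groups. Thus $K^{sm}_1(A)$ is the cokernel of $GL(\mathcal I(A))\to GL(A)$, $K^{sm}_2(A)$ is the kernel of $\pi_0GL(\mathcal I_*(A))\to GL(A)$, and $K^{sm}_n(A)=\pi_{n-2}GL(\mathcal I_*(A))$ for $n\ge 3$; similarly for $K^{top}_n$ and $\mathcal J$. Put $K^{sm}_0(A)=K^{top}_0(A)=K_0(A)=\ker(K_0(A^+)\to K_0(k))$. For $n\ge1$ the inclusion $\mathcal I(A)\subset\mathcal J(A)$ induces the homomorphism $\beta_n(A)\colon K^{sm}_n(A)\to K^{top}_n(A)$. **Theorem 1.13.** Let $A$ be a locally convex $k$-algebra and let $i\ge 0$ be an integer. Suppose that 1. the homomorphism $K^{sm}_{i+1}(A)\to K^{sm}_{i+1}(A^I)$ induced by the inclusion of the constant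 maps is an isomorphism, and 2. for every $j$ with $0\le j\le i$, the homomorphism $K^{sm}_j(A^{I^{i-j}})\to K^{sm}_j(A^{I^{i-j+2}})$ induced by the projection $I^{i-j+2}\to I^{i-j}$ onto the first $i-j$ coordinates is an isomorphism. Then $$\beta_{i+1}(A)\colon K^{sm}_{i+1}(A)\to K^{top}_{i+1}(A)$$ is an isomorphism. -/

import Mathlib

open CategoryTheory Topology
open scoped unitInterval

universe u

set_option linter.unusedSectionVars false

noncomputable section

namespace SmoothK

/-! ### Topological algebras

`TopAlg k` is the category of (possibly non-unital) Hausdorff topological `k`-algebras with jointly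
continuous multiplication, with the continuous `k`-algebra homomorphisms as morphisms. The complete
locally convex ones form a full subcategory. -/

structure TopAlg (k : Type) [RCLike k] : Type (u + 1) where
  carrier : Type u
  [ring : NonUnitalRing carrier]
  [module : Module k carrier]
  [tower : IsScalarTower k carrier carrier]
  [comm : SMulCommClass k carrier carrier]
  [top : TopologicalSpace carrier]
  [topRing : IsTopologicalRing carrier]
  [contSMul : ContinuousSMul k carrier]
  [t2 : T2Space carrier]

namespace TopAlg

variable {k : Type} [RCLike k]

instance : CoeSort (TopAlg.{u} k) (Type u) := ⟨TopAlg.carrier⟩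

attribute [instance] ring module tower comm top topRing contSMul t2

variable (k) in
/-- The object of `TopAlg k` given by a type with the relevant structures. -/
abbrev of (A : Type u) [NonUnitalRing A] [Module k A] [IsScalarTower k A A] [SMulCommClass k A A]
    [TopologicalSpace A] [IsTopologicalRing A] [ContinuousSMul k A] [T2Space A] : TopAlg.{u} k :=
  ⟨A⟩

/-- Continuous `k`-algebra homomorphisms. -/
@[ext]
structure Hom (A B : TopAlg.{u} k) where
  toFun : A →ₙₐ[k] B
  cont : Continuous toFun

instance : Category (TopAlg.{u} k) where
  Hom A B := Hom A B
  id A := ⟨NonUnitalAlgHom.id k A, continuous_id⟩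
  comp f g := ⟨g.toFun.comp f.toFun, g.cont.comp f.cont⟩

@[simp] theorem id_toFun (A : TopAlg.{u} k) (a : A) : Hom.toFun (𝟙 A) a = a := rfl

@[simp] theorem comp_toFun {A B C : TopAlg.{u} k} (f : A ⟶ B) (g : B ⟶ C) (a : A) :
    Hom.toFun (f ≫ g) a = Hom.toFun g (Hom.toFun f a) := rfl

theorem hom_ext {A B : TopAlg.{u} k} {f g : A ⟶ B}
    (h : ∀ a, Hom.toFun f a = Hom.toFun g a) : f = g :=
  Hom.ext (NonUnitalAlgHom.ext h)

end TopAlg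

/-! ### Continuous and smooth paths -/

section Paths

variable (k : Type) [RCLike k]

/-- The functor `A ↦ A^X` of continuous maps `X → A` with the compact-open topology (for compact `X`
the topology of the seminorms `f ↦ sup_x ‖f x‖_s`) and pointwise operations. -/
def contMaps (X : Type) [TopologicalSpace X] [LocallyCompactSpace X] :
    TopAlg.{u} k ⥤ TopAlg.{u} k where
  obj A := TopAlg.of k C(X, A)
  map {A B} φ :=
    { toFun :=
        { toFun := fun f => ⟨fun x => φ.toFun (f x), φ.cont.comp f.continuous⟩
          map_smul' := fun c f => by ext x; exact map_smul φ.toFun c (f x)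
          map_zero' := by ext x; exact map_zero φ.toFun
          map_add' := fun f g => by ext x; exact map_add φ.toFun (f x) (g x)
          map_mul' := fun f g => by ext x; exact map_mul φ.toFun (f x) (g x) }
      cont := ContinuousMap.continuous_postcomp ⟨φ.toFun, φ.cont⟩ }

/-- The homomorphism `A^Y → A^X` of composition with a continuous map `p : X → Y`. -/
def precomp {X Y : Type} [TopologicalSpace X] [LocallyCompactSpace X] [TopologicalSpace Y]
    [LocallyCompactSpace Y] (p : C(X, Y)) (A : TopAlg.{u} k) :
    (contMaps k Y).obj A ⟶ (contMaps k X).obj A where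
  toFun :=
    { toFun := fun f => f.comp p
      map_smul' := fun _ _ => rfl
      map_zero' := rfl
      map_add' := fun _ _ => rfl
      map_mul' := fun _ _ => rfl }
  cont := ContinuousMap.continuous_precomp p

/-- The inclusion `A → A^X` as constant maps. -/
def constMaps (X : Type) [TopologicalSpace X] [LocallyCompactSpace X] :
    𝟭 (TopAlg.{u} k) ⟶ contMaps k X where
  app A :=
    { toFun :=
        { toFun := fun a => ContinuousMap.const X (a : A)
          map_smul' := fun _ _ => rfl
          map_zero' := rfl
          map_add' := fun _ _ => rfl
          map_mul' := fun _ _ => rfl }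
      cont := ContinuousMap.continuous_const' }

/-- Evaluation `A^X → A` at a point. -/
def evalMaps (X : Type) [TopologicalSpace X] [LocallyCompactSpace X] (x : X) :
    contMaps k X ⟶ 𝟭 (TopAlg.{u} k) where
  app A :=
    { toFun :=
        { toFun := fun f => ContinuousMap.toFun (X := X) (Y := A) f x
          map_smul' := fun _ _ => rfl
          map_zero' := rfl
          map_add' := fun _ _ => rfl
          map_mul' := fun _ _ => rfl }
      cont := continuous_eval_const (F := C(X, A)) x }

/-- `f : I → A` has derivative `a` at `t` (one-sided at the endpoints of `I`). -/
def HasPathDeriv {A : Type u} [AddCommGroup A] [Module k A] [TopologicalSpace A]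
    (f : I → A) (a : A) (t : I) : Prop :=
  Filter.Tendsto (fun s : I => (((s : ℝ) - (t : ℝ) : ℝ) : k)⁻¹ • (f s - f t)) (𝓝[≠] t) (𝓝 a)

/-- `f : I → A` has derivatives of all orders: `g n` is the `n`-th derivative. -/
def IsSmoothPath {A : Type u} [AddCommGroup A] [Module k A] [TopologicalSpace A]
    (f : C(I, A)) : Prop :=
  ∃ g : ℕ → C(I, A), g 0 = f ∧ ∀ n t, HasPathDeriv k (g n) (g (n + 1) t) t

section

variable {k} {A : Type u} [NonUnitalRing A] [Module k A] [IsScalarTower k A A] [SMulCommClass k A A]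
  [TopologicalSpace A] [IsTopologicalRing A] [ContinuousSMul k A]

theorem HasPathDeriv.add {f g : I → A} {a b : A} {t : I} (hf : HasPathDeriv k f a t)
    (hg : HasPathDeriv k g b t) : HasPathDeriv k (f + g) (a + b) t := by
  refine (Filter.Tendsto.add hf hg).congr fun s => ?_
  rw [← smul_add]; congr 1; simp only [Pi.add_apply]; abel

theorem HasPathDeriv.smul (c : k) {f : I → A} {a : A} {t : I} (hf : HasPathDeriv k f a t) :
    HasPathDeriv k (c • f) (c • a) t := by
  refine (Filter.Tendsto.const_smul hf c).congr fun s => ?_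
  rw [smul_comm, Pi.smul_apply, Pi.smul_apply, smul_sub]

theorem HasPathDeriv.const (a : A) (t : I) : HasPathDeriv k (fun _ : I => a) 0 t := by
  refine tendsto_const_nhds.congr fun s => ?_
  simp

theorem HasPathDeriv.mul {f g : I → A} {a b : A} {t : I} (hf : HasPathDeriv k f a t)
    (hg : HasPathDeriv k g b t) (hc : Continuous g) :
    HasPathDeriv k (f * g) (a * g t + f t * b) t := by
  have hgt : Filter.Tendsto g (𝓝[≠] t) (𝓝 (g t)) := (hc.tendsto t).mono_left nhdsWithin_le_nhds
  refine ((Filter.Tendsto.mul hf hgt).add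
    (Filter.Tendsto.mul (tendsto_const_nhds (x := f t)) hg)).congr fun s => ?_
  rw [smul_mul_assoc, mul_smul_comm, ← smul_add]; congr 1
  simp only [Pi.mul_apply]; noncomm_ring

theorem HasPathDeriv.map {B : Type u} [AddCommGroup B] [Module k B] [TopologicalSpace B]
    (φ : A →ₗ[k] B) (hφ : Continuous φ) {f : I → A} {a : A} {t : I} (hf : HasPathDeriv k f a t) :
    HasPathDeriv k (fun s => φ (f s)) (φ a) t := by
  refine ((hφ.tendsto a).comp hf).congr fun s => ?_
  simp

theorem HasPathDeriv.unique [T2Space A] {f : I → A} {a b : A} {t : I} (ha : HasPathDeriv k f a t)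
    (hb : HasPathDeriv k f b t) : a = b :=
  tendsto_nhds_unique ha hb

/-- A path is smooth as soon as it lies in a set of paths stable under differentiation. -/
theorem IsSmoothPath.of_set (S : Set C(I, A))
    (hS : ∀ f ∈ S, ∃ f' ∈ S, ∀ t, HasPathDeriv k f (f' t) t) {f : C(I, A)} (hf : f ∈ S) :
    IsSmoothPath k f := by
  choose! D hD hD' using hS
  have key : ∀ n, D^[n] f ∈ S := fun n => by
    induction n with
    | zero => exact hf
    | succ n ih => rw [Function.iterate_succ_apply']; exact hD _ ih
  refine ⟨fun n => D^[n] f, rfl, fun n t => ?_⟩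
  simp only [Function.iterate_succ_apply']
  exact hD' _ (key n) t

theorem IsSmoothPath.exists_deriv {f : C(I, A)} (hf : IsSmoothPath k f) :
    ∃ f' : C(I, A), IsSmoothPath k f' ∧ ∀ t, HasPathDeriv k f (f' t) t := by
  obtain ⟨g, rfl, hg⟩ := hf
  exact ⟨g 1, ⟨fun n => g (n + 1), rfl, fun n t => hg (n + 1) t⟩, hg 0⟩

theorem IsSmoothPath.add {f g : C(I, A)} (hf : IsSmoothPath k f) (hg : IsSmoothPath k g) :
    IsSmoothPath k (f + g) := by
  obtain ⟨F, rfl, hF⟩ := hf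
  obtain ⟨G, rfl, hG⟩ := hg
  exact ⟨fun n => F n + G n, rfl, fun n t => (hF n t).add (hG n t)⟩

theorem IsSmoothPath.smul (c : k) {f : C(I, A)} (hf : IsSmoothPath k f) :
    IsSmoothPath k (c • f) := by
  obtain ⟨F, rfl, hF⟩ := hf
  exact ⟨fun n => c • F n, rfl, fun n t => (hF n t).smul c⟩

theorem IsSmoothPath.const (a : A) : IsSmoothPath k (ContinuousMap.const I a) :=
  IsSmoothPath.of_set (Set.range fun a : A => ContinuousMap.const I a)
    (by rintro _ ⟨a, rfl⟩; exact ⟨_, ⟨0, rfl⟩, fun t => HasPathDeriv.const a t⟩) ⟨a, rfl⟩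

theorem IsSmoothPath.mul {f g : C(I, A)} (hf : IsSmoothPath k f) (hg : IsSmoothPath k g) :
    IsSmoothPath k (f * g) := by
  let M : Set C(I, A) := {h | ∃ a b, IsSmoothPath k a ∧ IsSmoothPath k b ∧ h = a * b}
  refine IsSmoothPath.of_set (AddSubmonoid.closure M : Set C(I, A)) ?_
    (AddSubmonoid.subset_closure ⟨f, g, hf, hg, rfl⟩)
  intro h hh
  induction hh using AddSubmonoid.closure_induction with
  | mem x hx =>
    obtain ⟨a, b, ha, hb, rfl⟩ := hx
    obtain ⟨a', ha', hda⟩ := ha.exists_deriv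
    obtain ⟨b', hb', hdb⟩ := hb.exists_deriv
    exact ⟨a' * b + a * b', add_mem (AddSubmonoid.subset_closure ⟨_, _, ha', hb, rfl⟩)
      (AddSubmonoid.subset_closure ⟨_, _, ha, hb', rfl⟩),
      fun t => (hda t).mul (hdb t) b.continuous⟩
  | zero => exact ⟨0, zero_mem _, fun t => HasPathDeriv.const 0 t⟩
  | add x y _ _ hx hy =>
    obtain ⟨x', hx', hdx⟩ := hx
    obtain ⟨y', hy', hdy⟩ := hy
    exact ⟨x' + y', add_mem hx' hy', fun t => (hdx t).add (hdy t)⟩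

end

/-- The smooth paths, as a subalgebra of `A^I`. -/
def smoothSubalgebra (A : Type u) [NonUnitalRing A] [Module k A] [IsScalarTower k A A]
    [SMulCommClass k A A] [TopologicalSpace A] [IsTopologicalRing A] [ContinuousSMul k A] :
    NonUnitalSubalgebra k C(I, A) where
  carrier := {f | IsSmoothPath k f}
  add_mem' := IsSmoothPath.add
  zero_mem' := IsSmoothPath.const 0
  mul_mem' := IsSmoothPath.mul
  smul_mem' := fun c _ hf => hf.smul c

end Paths

section SmoothPaths

variable {k : Type} [RCLike k] (A : TopAlg.{u} k)

/-- The algebra `A^{∞(I)}` of smooth maps `I → A`. It does not carry the topology of `A^I`. -/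
def SmoothPath : Type u := smoothSubalgebra k A

namespace SmoothPath

instance : NonUnitalRing (SmoothPath A) := inferInstanceAs (NonUnitalRing (smoothSubalgebra k A))
instance : Module k (SmoothPath A) := inferInstanceAs (Module k (smoothSubalgebra k A))
instance : IsScalarTower k (SmoothPath A) (SmoothPath A) :=
  inferInstanceAs (IsScalarTower k (smoothSubalgebra k A) (smoothSubalgebra k A))
instance : SMulCommClass k (SmoothPath A) (SmoothPath A) :=
  inferInstanceAs (SMulCommClass k (smoothSubalgebra k A) (smoothSubalgebra k A))

/-- The underlying continuous path. -/
def incl : SmoothPath A →ₙₐ[k] C(I, A) :=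
  NonUnitalSubalgebraClass.subtype (smoothSubalgebra k A)

variable {A}

theorem incl_injective : Function.Injective (incl A) := Subtype.val_injective

theorem isSmoothPath (f : SmoothPath A) : IsSmoothPath k (incl A f) := f.2

/-- The derivative of a smooth path. -/
def derivFun (f : SmoothPath A) : SmoothPath A :=
  ⟨f.isSmoothPath.exists_deriv.choose, f.isSmoothPath.exists_deriv.choose_spec.1⟩

theorem hasPathDeriv (f : SmoothPath A) (t : I) :
    HasPathDeriv k (incl A f) (incl A (derivFun f) t) t :=
  f.isSmoothPath.exists_deriv.choose_spec.2 t

theorem derivFun_eq {f f' : SmoothPath A}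
    (h : ∀ t, HasPathDeriv k (incl A f) (incl A f' t) t) : derivFun f = f' :=
  incl_injective (ContinuousMap.ext fun t => (hasPathDeriv f t).unique (h t))

variable (A) in
/-- Differentiation, as a linear endomorphism of `A^{∞(I)}`. -/
def deriv : SmoothPath A →ₗ[k] SmoothPath A where
  toFun := derivFun
  map_add' f g := derivFun_eq fun t => by
    rw [map_add, map_add]; exact (hasPathDeriv f t).add (hasPathDeriv g t)
  map_smul' c f := derivFun_eq fun t => by
    rw [map_smul, RingHom.id_apply, map_smul]; exact (hasPathDeriv f t).smul c

theorem deriv_mul (f g : SmoothPath A) : deriv A (f * g) = deriv A f * g + f * deriv A g :=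
  derivFun_eq fun t => by
    rw [map_mul, map_add, map_mul, map_mul]
    exact (hasPathDeriv f t).mul (hasPathDeriv g t) (incl A g).continuous

variable (A) in
/-- The sequence of all derivatives of a smooth path. -/
def jet : SmoothPath A →ₗ[k] (ℕ → C(I, A)) :=
  LinearMap.pi fun n => (incl A : SmoothPath A →ₗ[k] C(I, A)) ∘ₗ (deriv A ^ n)

theorem jet_apply (f : SmoothPath A) (n : ℕ) : jet A f n = incl A ((deriv A ^ n) f) := rfl

theorem jet_succ (f : SmoothPath A) (n : ℕ) : jet A f (n + 1) = jet A (deriv A f) n := by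
  simp [jet_apply, pow_succ]

theorem jet_injective : Function.Injective (jet A) := fun f g h =>
  incl_injective (by simpa [jet_apply] using congrFun h 0)

/-- The topology of uniform convergence of all derivatives, that is, the topology of the seminorms
`f ↦ sup_t ∑_{n ≤ r} ‖f^{(n)} t‖_s`. -/
instance : TopologicalSpace (SmoothPath A) := TopologicalSpace.induced (jet A) inferInstance

theorem continuous_iff {X : Type*} [TopologicalSpace X] {φ : X → SmoothPath A} :
    Continuous φ ↔ ∀ n, Continuous fun x => jet A (φ x) n :=
  continuous_induced_rng.trans continuous_pi_iff

theorem continuous_jet (n : ℕ) : Continuous fun f : SmoothPath A => jet A f n :=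
  continuous_iff.1 continuous_id n

theorem continuous_incl : Continuous (incl A) := continuous_jet 0

theorem continuous_deriv : Continuous (deriv A) :=
  continuous_iff.2 fun n => by simpa only [← jet_succ] using continuous_jet (n + 1)

instance : IsTopologicalAddGroup (SmoothPath A) := topologicalAddGroup_induced (jet A)

instance : ContinuousSMul k (SmoothPath A) := continuousSMul_induced (jet A)

instance : T2Space (SmoothPath A) :=
  T2Space.of_injective_continuous jet_injective continuous_induced_dom

instance : ContinuousMul (SmoothPath A) where
  continuous_mul := by
    refine continuous_iff.2 fun n => ?_
    suffices h : ∀ (n : ℕ) (X : Type u) [TopologicalSpace X] (a b : X → SmoothPath A),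
        Continuous a → Continuous b → Continuous fun x => jet A (a x * b x) n from
      h n _ _ _ continuous_fst continuous_snd
    intro n
    induction n with
    | zero =>
      intro X _ a b ha hb
      have : (fun x => jet A (a x * b x) 0) = fun x => incl A (a x) * incl A (b x) := by
        funext x; simp [jet_apply]
      rw [this]
      exact (continuous_incl.comp ha).mul (continuous_incl.comp hb)
    | succ n ih =>
      intro X _ a b ha hb
      simp only [jet_succ, deriv_mul, map_add, Pi.add_apply]
      exact (ih X _ _ (continuous_deriv.comp ha) hb).add (ih X _ _ ha (continuous_deriv.comp hb))

instance : IsTopologicalRing (SmoothPath A) where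
  continuous_neg := continuous_neg

end SmoothPath

end SmoothPaths

section SmoothFunctor

variable (k : Type) [RCLike k]

/-- The homomorphism `A^{∞(I)} → B^{∞(I)}` induced by `A → B`. -/
def SmoothPath.mapFun {A B : TopAlg.{u} k} (φ : A ⟶ B) : SmoothPath A →ₙₐ[k] SmoothPath B where
  toFun f := ⟨((contMaps k I).map φ).toFun (incl A f), by
    obtain ⟨g, h0, hg⟩ := f.isSmoothPath
    refine ⟨fun n => ((contMaps k I).map φ).toFun (g n),
      congrArg (fun x => ((contMaps k I).map φ).toFun x) h0, fun n t => ?_⟩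
    exact (hg n t).map (φ.toFun : A →ₗ[k] B) φ.cont⟩
  map_smul' c f := incl_injective (map_smul (((contMaps k I).map φ).toFun.comp (incl A)) c f)
  map_zero' := incl_injective (map_zero (((contMaps k I).map φ).toFun.comp (incl A)))
  map_add' f g := incl_injective (map_add (((contMaps k I).map φ).toFun.comp (incl A)) f g)
  map_mul' f g := incl_injective (map_mul (((contMaps k I).map φ).toFun.comp (incl A)) f g)

theorem SmoothPath.deriv_mapFun {A B : TopAlg.{u} k} (φ : A ⟶ B) (f : SmoothPath A) :
    deriv B (mapFun k φ f) = mapFun k φ (deriv A f) :=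
  derivFun_eq fun t => (hasPathDeriv f t).map (φ.toFun : A →ₗ[k] B) φ.cont

theorem SmoothPath.jet_mapFun {A B : TopAlg.{u} k} (φ : A ⟶ B) (n : ℕ) (f : SmoothPath A) :
    jet B (mapFun k φ f) n = ((contMaps k I).map φ).toFun (jet A f n) := by
  induction n generalizing f with
  | zero => rfl
  | succ n ih => rw [jet_succ, jet_succ, deriv_mapFun, ih]

/-- The functor `A ↦ A^{∞(I)}`. -/
def smoothMaps : TopAlg.{u} k ⥤ TopAlg.{u} k where
  obj A := TopAlg.of k (SmoothPath A)
  map {A B} φ :=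
    { toFun := SmoothPath.mapFun k φ
      cont := SmoothPath.continuous_iff.2 fun n => by
        simp only [SmoothPath.jet_mapFun]
        exact ((contMaps k I).map φ).cont.comp (SmoothPath.continuous_jet n) }

/-- The inclusion `A^{∞(I)} → A^I`. -/
def smoothIncl : smoothMaps.{u} k ⟶ contMaps k I where
  app A := ⟨SmoothPath.incl A, SmoothPath.continuous_incl⟩

/-- The inclusion `A → A^{∞(I)}` as constant paths. -/
def smoothConst : 𝟭 (TopAlg.{u} k) ⟶ smoothMaps k where
  app A :=
    { toFun :=
        { toFun := fun a => ⟨ContinuousMap.const I (a : A), IsSmoothPath.const _⟩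
          map_smul' := fun _ _ => rfl
          map_zero' := rfl
          map_add' := fun _ _ => rfl
          map_mul' := fun _ _ => rfl }
      cont := SmoothPath.continuous_iff.2 fun n => by
        cases n with
        | zero => exact ContinuousMap.continuous_const'
        | succ n =>
          refine continuous_zero.congr fun a => ?_
          have h : SmoothPath.deriv A ⟨ContinuousMap.const I (a : A),
              IsSmoothPath.const _⟩ = 0 :=
            SmoothPath.derivFun_eq fun t => HasPathDeriv.const _ t
          exact ((SmoothPath.jet_succ _ n).trans ((congrArg (fun x => SmoothPath.jet A x n) h).trans
            (congrFun (map_zero (SmoothPath.jet A)) n))).symm }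

end SmoothFunctor

/-! ### Path functors, their kernels and the face maps -/

section PathFunctors

variable (k : Type) [RCLike k]

/-- A functor of paths: evaluations `ε₀, ε₁ : A^{(I)} → A` together with the constant paths. -/
structure PathFunctor where
  paths : TopAlg.{u} k ⥤ TopAlg.{u} k
  ev₀ : paths ⟶ 𝟭 (TopAlg.{u} k)
  ev₁ : paths ⟶ 𝟭 (TopAlg.{u} k)
  const : 𝟭 (TopAlg.{u} k) ⟶ paths
  const_ev₀ : const ≫ ev₀ = 𝟙 _
  const_ev₁ : const ≫ ev₁ = 𝟙 _

/-- The continuous paths `A^I`. -/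
def contPaths : PathFunctor.{u} k where
  paths := contMaps k I
  ev₀ := evalMaps k I 0
  ev₁ := evalMaps k I 1
  const := constMaps k I
  const_ev₀ := rfl
  const_ev₁ := rfl

/-- The smooth paths `A^{∞(I)}`. -/
def smoothPaths : PathFunctor.{u} k where
  paths := smoothMaps k
  ev₀ := smoothIncl k ≫ evalMaps k I 0
  ev₁ := smoothIncl k ≫ evalMaps k I 1
  const := smoothConst k
  const_ev₀ := rfl
  const_ev₁ := rfl

/-- A morphism of path functors. -/
structure PathFunctor.Hom (P Q : PathFunctor.{u} k) where
  hom : P.paths ⟶ Q.paths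
  comm₀ : hom ≫ Q.ev₀ = P.ev₀
  comm₁ : hom ≫ Q.ev₁ = P.ev₁

/-- Smooth paths are continuous. -/
def smoothToCont : PathFunctor.Hom k (smoothPaths.{u} k) (contPaths k) where
  hom := smoothIncl k
  comm₀ := rfl
  comm₁ := rfl

variable {k}

/-- The kernel of a homomorphism, with the subspace topology. -/
def kerSubalgebra {A B : TopAlg.{u} k} (φ : A ⟶ B) : NonUnitalSubalgebra k A where
  carrier := {a | φ.toFun a = 0}
  add_mem' {a b} ha hb := by
    change φ.toFun (a + b) = 0
    rw [map_add, show φ.toFun a = 0 from ha, show φ.toFun b = 0 from hb, add_zero]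
  zero_mem' := map_zero φ.toFun
  mul_mem' {a b} ha _ := by
    change φ.toFun (a * b) = 0
    rw [map_mul, show φ.toFun a = 0 from ha, zero_mul]
  smul_mem' c a ha := by
    change φ.toFun (c • a) = 0
    rw [map_smul, show φ.toFun a = 0 from ha, smul_zero]

/-- The homomorphism of kernels induced by a commutative square. -/
def kerMap {A B A' B' : TopAlg.{u} k} (φ : A ⟶ B) (φ' : A' ⟶ B') (a : A ⟶ A') (b : B ⟶ B')
    (h : a ≫ φ' = φ ≫ b) :
    TopAlg.of k (kerSubalgebra φ) ⟶ TopAlg.of k (kerSubalgebra φ') where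
  toFun := NonUnitalAlgHom.codRestrict
    (a.toFun.comp (NonUnitalSubalgebraClass.subtype (kerSubalgebra φ))) (kerSubalgebra φ')
    fun x => by
      have h1 : TopAlg.Hom.toFun (a ≫ φ') x.1 = TopAlg.Hom.toFun (φ ≫ b) x.1 := by rw [h]
      have h2 : TopAlg.Hom.toFun φ x.1 = 0 := x.2
      change TopAlg.Hom.toFun φ' (TopAlg.Hom.toFun a x.1) = 0
      rw [TopAlg.comp_toFun, TopAlg.comp_toFun, h2, map_zero] at h1
      exact h1
  cont := (a.cont.comp continuous_subtype_val).subtype_mk _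

variable (k)

namespace PathFunctor

variable {k} (P : PathFunctor.{u} k)

/-- The path algebra: the kernel of `ε₀`. -/
def ker : TopAlg.{u} k ⥤ TopAlg.{u} k where
  obj A := TopAlg.of k (kerSubalgebra (P.ev₀.app A))
  map φ := kerMap _ _ (P.paths.map φ) φ (P.ev₀.naturality φ)
  map_id A := TopAlg.hom_ext fun x => Subtype.ext
    (congrArg (fun ψ => TopAlg.Hom.toFun ψ x.1) (P.paths.map_id A))
  map_comp φ ψ := TopAlg.hom_ext fun x => Subtype.ext
    (congrArg (fun χ => TopAlg.Hom.toFun χ x.1) (P.paths.map_comp φ ψ))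

/-- The inclusion of the kernel of `ε₀`. -/
def ι : P.ker ⟶ P.paths where
  app A := ⟨NonUnitalSubalgebraClass.subtype (kerSubalgebra (P.ev₀.app A)), continuous_subtype_val⟩

/-- The augmentation `τ`, the restriction of `ε₁` to the kernel of `ε₀`. -/
def τ : P.ker ⟶ 𝟭 (TopAlg.{u} k) := P.ι ≫ P.ev₁

/-- The `n`-fold iterate of the path algebra functor; `P.iter (n + 1)` is the term of simplicial
degree `n` of the resolution, and `P.iter 0` is the identity (the term of degree `-1`). -/
def iter : ℕ → (TopAlg.{u} k ⥤ TopAlg.{u} k)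
  | 0 => 𝟭 _
  | n + 1 => iter n ⋙ P.ker

/-- The face `δ_i = P^i τ P^{n-i} : P^{n+1} → P^n`. -/
def face : ∀ n : ℕ, Fin (n + 1) → (P.iter (n + 1) ⟶ P.iter n)
  | 0, _ => P.τ
  | n + 1, i => Fin.cases (motive := fun _ => P.iter (n + 2) ⟶ P.iter (n + 1))
      (Functor.whiskerLeft (P.iter (n + 1)) P.τ)
      (fun i => Functor.whiskerRight (face n i) P.ker) i

theorem face_zero (n : ℕ) (A : TopAlg.{u} k) :
    (P.face n 0).app A = P.τ.app ((P.iter n).obj A) := by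
  cases n <;> rfl

theorem face_succ (n : ℕ) (i : Fin (n + 1)) (A : TopAlg.{u} k) :
    (P.face (n + 1) i.succ).app A = P.ker.map ((P.face n i).app A) := rfl

theorem face_face (n : ℕ) (i j : Fin (n + 1)) (hij : i ≤ j) (A : TopAlg.{u} k) :
    (P.face (n + 1) j.succ).app A ≫ (P.face n i).app A =
      (P.face (n + 1) i.castSucc).app A ≫ (P.face n j).app A := by
  induction n with
  | zero =>
    obtain rfl : i = 0 := Subsingleton.elim (α := Fin 1) _ _
    obtain rfl : j = 0 := Subsingleton.elim (α := Fin 1) _ _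
    exact P.τ.naturality ((P.face 0 0).app A)
  | succ n ih =>
    induction i using Fin.cases with
    | zero =>
      rw [face_succ, Fin.castSucc_zero, face_zero, face_zero]
      exact P.τ.naturality ((P.face (n + 1) j).app A)
    | succ i =>
      induction j using Fin.cases with
      | zero => exact absurd hij (by simp)
      | succ j =>
        rw [Fin.castSucc_succ, face_succ, face_succ, face_succ, face_succ]
        have h := ih i j (Fin.succ_le_succ_iff.1 hij)
        exact (P.ker.map_comp _ _).symm.trans ((congrArg P.ker.map h).trans (P.ker.map_comp _ _))

variable {P} {Q : PathFunctor.{u} k} (f : Hom k P Q)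

/-- The morphism of path algebras induced by a morphism of path functors. -/
def Hom.ker : P.ker ⟶ Q.ker where
  app A := kerMap _ _ (f.hom.app A) (𝟙 A) (congrArg (fun α => NatTrans.app α A) f.comm₀)
  naturality _ _ φ := TopAlg.hom_ext fun x => Subtype.ext
    (congrArg (fun ψ => TopAlg.Hom.toFun ψ x.1) (f.hom.naturality φ))

theorem Hom.ker_τ (A : TopAlg.{u} k) : f.ker.app A ≫ Q.τ.app A = P.τ.app A :=
  TopAlg.hom_ext fun x => congrArg (fun α => TopAlg.Hom.toFun (NatTrans.app α A) x.1) f.comm₁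

/-- The induced morphisms of iterated path algebras. -/
def Hom.iter : ∀ n : ℕ, P.iter n ⟶ Q.iter n
  | 0 => 𝟙 _
  | n + 1 => Hom.iter n ◫ f.ker

theorem Hom.iter_succ (n : ℕ) (A : TopAlg.{u} k) :
    (f.iter (n + 1)).app A =
      f.ker.app ((P.iter n).obj A) ≫ Q.ker.map ((f.iter n).app A) := rfl

theorem Hom.iter_face (n : ℕ) (i : Fin (n + 1)) (A : TopAlg.{u} k) :
    (f.iter (n + 1)).app A ≫ (Q.face n i).app A = (P.face n i).app A ≫ (f.iter n).app A := by
  have zero : ∀ n : ℕ, (f.iter (n + 1)).app A ≫ (Q.face n 0).app A =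
      (P.face n 0).app A ≫ (f.iter n).app A := fun n => by
    rw [face_zero, face_zero]
    exact (Category.assoc _ _ _).trans
      ((congrArg (f.ker.app ((P.iter n).obj A) ≫ ·) (Q.τ.naturality ((f.iter n).app A))).trans
        ((Category.assoc _ _ _).symm.trans
          (congrArg (· ≫ (f.iter n).app A) (f.ker_τ ((P.iter n).obj A)))))
  induction n with
  | zero => rw [Subsingleton.elim (α := Fin 1) i 0]; exact zero 0
  | succ n ih =>
    induction i using Fin.cases with
    | zero => exact zero (n + 1)
    | succ i =>
      rw [face_succ, face_succ]
      exact (Category.assoc _ _ _).trans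
        ((congrArg (f.ker.app ((P.iter (n + 1)).obj A) ≫ ·)
          ((Q.ker.map_comp _ _).symm.trans ((congrArg Q.ker.map (ih i)).trans
            (Q.ker.map_comp _ _)))).trans
          ((Category.assoc _ _ _).symm.trans
            ((congrArg (· ≫ Q.ker.map ((f.iter n).app A))
              (f.ker.naturality ((P.face n i).app A)).symm).trans (Category.assoc _ _ _))))

end PathFunctor

end PathFunctors

/-! ### The general linear group of a non-unital algebra -/

section GeneralLinear

/-- The stabilization `M ↦ M ⊕ 1` from `m × m` to `n × n` matrices, for `m ≤ n`. -/
def stab {R : Type*} [Ring R] {m n : ℕ} (M : Matrix (Fin m) (Fin m) R) :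
    Matrix (Fin n) (Fin n) R :=
  Matrix.of fun a b =>
    if ha : (a : ℕ) < m then
      if hb : (b : ℕ) < m then M ⟨a, ha⟩ ⟨b, hb⟩ else 0
    else if a = b then 1 else 0

section

variable {R : Type*} [Ring R] {m n p : ℕ}

theorem stab_one (_h : m ≤ n) :
    (stab (1 : Matrix (Fin m) (Fin m) R) : Matrix (Fin n) (Fin n) R) = 1 := by
  ext a b
  simp only [stab, Matrix.of_apply, Matrix.one_apply, Fin.ext_iff]
  split_ifs <;> first | rfl | omega

theorem stab_mul (h : m ≤ n) (M N : Matrix (Fin m) (Fin m) R) :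
    (stab (M * N) : Matrix (Fin n) (Fin n) R) = stab M * stab N := by
  obtain ⟨d, rfl⟩ := Nat.exists_eq_add_of_le h
  ext a b
  rw [Matrix.mul_apply, Fin.sum_univ_add]
  by_cases ha : (a : ℕ) < m
  · by_cases hb : (b : ℕ) < m
    · simp [stab, ha, hb, Matrix.mul_apply]
    · simp [stab, ha, hb]
  · have h1 : ∀ x : Fin m, a ≠ Fin.castAdd d x := fun x hx => ha (by rw [hx]; simp)
    obtain ⟨c, rfl⟩ : ∃ c, a = Fin.natAdd m c :=
      ⟨⟨a - m, by omega⟩, Fin.ext (by simp only [Fin.val_natAdd]; omega)⟩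
    rw [Finset.sum_eq_zero fun x _ => by simp [stab, h1], zero_add,
      Finset.sum_eq_single c (fun x _ hx => by simp [stab, Ne.symm hx]) (by simp)]
    simp [stab]

theorem stab_self (M : Matrix (Fin m) (Fin m) R) : stab M = M := by
  ext a b; simp [stab]

theorem stab_stab (h : m ≤ n) (_h' : n ≤ p) (M : Matrix (Fin m) (Fin m) R) :
    (stab (stab M : Matrix (Fin n) (Fin n) R) : Matrix (Fin p) (Fin p) R) = stab M := by
  ext a b
  simp only [stab, Matrix.of_apply, Fin.ext_iff]
  split_ifs <;> first | rfl | omega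

theorem stab_map {S : Type*} [Ring S] (φ : R →+* S) (M : Matrix (Fin m) (Fin m) R) :
    (stab (M.map φ) : Matrix (Fin n) (Fin n) S) = (stab M).map φ := by
  ext a b
  simp only [stab, Matrix.of_apply, Matrix.map_apply]
  split_ifs <;> simp

/-- Stabilization of invertible matrices. -/
def stabUnits (h : m ≤ n) :
    (Matrix (Fin m) (Fin m) R)ˣ →* (Matrix (Fin n) (Fin n) R)ˣ :=
  Units.map { toFun := stab, map_one' := stab_one h, map_mul' := stab_mul h }

end

/-- The homomorphism `GL_m(R) → GL_m(S)` induced by a ring homomorphism. -/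
def unitsMap {R S : Type*} [Ring R] [Ring S] (m : ℕ) (φ : R →+* S) :
    (Matrix (Fin m) (Fin m) R)ˣ →* (Matrix (Fin m) (Fin m) S)ˣ :=
  Units.map (RingHom.toMonoidHom φ.mapMatrix)

variable {k : Type} [RCLike k]

/-- The unital algebra `A⁺ = A + k`. -/
abbrev Plus (A : TopAlg.{u} k) : Type u := Unitization k A

/-- The projection `A⁺ → k`. -/
def plusFst (A : TopAlg.{u} k) : Plus A →+* k := (Unitization.fstHom k A).toRingHom

/-- The homomorphism `A⁺ → B⁺` induced by `A → B`. -/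
def plusMap {A B : TopAlg.{u} k} (φ : A ⟶ B) : Plus A →+* Plus B :=
  (Unitization.lift ((Unitization.inrNonUnitalAlgHom k B).comp φ.toFun)).toRingHom

theorem plusMap_fst {A B : TopAlg.{u} k} (φ : A ⟶ B) (x : Plus A) :
    (plusMap φ x).fst = x.fst := by
  simp [plusMap, Unitization.algebraMap_eq_inl]

theorem plusMap_snd {A B : TopAlg.{u} k} (φ : A ⟶ B) (x : Plus A) :
    (plusMap φ x).snd = φ.toFun x.snd := by
  simp [plusMap, Unitization.algebraMap_eq_inl]

theorem plusMap_id (A : TopAlg.{u} k) : plusMap (𝟙 A) = RingHom.id (Plus A) :=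
  RingHom.ext fun x => Unitization.ext (plusMap_fst _ x) (plusMap_snd _ x)

theorem plusMap_comp {A B C : TopAlg.{u} k} (φ : A ⟶ B) (ψ : B ⟶ C) :
    plusMap (φ ≫ ψ) = (plusMap ψ).comp (plusMap φ) :=
  RingHom.ext fun x => Unitization.ext
    (by rw [RingHom.comp_apply, plusMap_fst, plusMap_fst, plusMap_fst])
    (by rw [RingHom.comp_apply, plusMap_snd, plusMap_snd, plusMap_snd]; rfl)

theorem plusFst_plusMap {A B : TopAlg.{u} k} (φ : A ⟶ B) (x : Plus A) :
    plusFst B (plusMap φ x) = plusFst A x := plusMap_fst φ x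

/-- `GL_m(A)`, the kernel of `GL_m(A⁺) → GL_m(k)`. -/
def GLm (m : ℕ) (A : TopAlg.{u} k) : Subgroup (Matrix (Fin m) (Fin m) (Plus A))ˣ :=
  (unitsMap m (plusFst A)).ker

theorem mem_GLm {m : ℕ} {A : TopAlg.{u} k} {g : (Matrix (Fin m) (Fin m) (Plus A))ˣ} :
    g ∈ GLm m A ↔ g.val.map (plusFst A) = 1 :=
  MonoidHom.mem_ker.trans Units.ext_iff

/-- The stabilization `GL_m(A) → GL_n(A)`, `m ≤ n`. -/
def stabGL (A : TopAlg.{u} k) {m n : ℕ} (h : m ≤ n) : GLm m A →* GLm n A :=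
  ((stabUnits h).comp (GLm m A).subtype).codRestrict (GLm n A) fun g => mem_GLm.2 <| by
    change (stab g.1.val).map (plusFst A) = 1
    rw [← stab_map, mem_GLm.1 g.2, stab_one h]

theorem stabGL_val (A : TopAlg.{u} k) {m n : ℕ} (h : m ≤ n) (g : GLm m A) :
    (stabGL A h g).1.val = stab g.1.val := rfl

theorem GLm_ext {m : ℕ} {A : TopAlg.{u} k} {g g' : GLm m A} (h : g.1.val = g'.1.val) : g = g' :=
  Subtype.ext (Units.ext h)

instance (A : TopAlg.{u} k) :
    DirectedSystem (fun m => GLm m A) (fun _ _ h => stabGL A h) where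
  map_self _ _ := GLm_ext (stab_self _)
  map_map _ _ _ hij hjk _ := GLm_ext (stab_stab hij hjk _)

/-- The group `GL(A)`, the union of the groups `GL_m(A)`. -/
def GLType (A : TopAlg.{u} k) : Type u :=
  DirectLimit (fun m => GLm m A) (fun _ _ h => stabGL A h)

instance (A : TopAlg.{u} k) : Group (GLType A) :=
  inferInstanceAs (Group (DirectLimit (fun m => GLm m A) (fun _ _ h => stabGL A h)))

/-- The homomorphism `GL_m(A) → GL(A)`. -/
def GLof (m : ℕ) (A : TopAlg.{u} k) : GLm m A →* GLType A where
  toFun g := Quotient.mk _ ⟨m, g⟩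
  map_one' := (DirectLimit.one_def (f := fun _ _ h => stabGL A h) m).symm
  map_mul' x y := (DirectLimit.mul_def (f := fun _ _ h => stabGL A h) m x y).symm

theorem GLof_eq_iff {A : TopAlg.{u} k} {m n : ℕ} {x : GLm m A} {y : GLm n A} :
    GLof m A x = GLof n A y ↔
      ∃ (p : ℕ) (hm : m ≤ p) (hn : n ≤ p), stabGL A hm x = stabGL A hn y :=
  Quotient.eq (r := DirectLimit.setoid (fun _ _ h => stabGL A h))

theorem GLof_stabGL {A : TopAlg.{u} k} {m n : ℕ} (h : m ≤ n) (x : GLm m A) :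
    GLof n A (stabGL A h x) = GLof m A x :=
  GLof_eq_iff.2 ⟨n, le_rfl, h, GLm_ext (stab_self _)⟩

theorem exists_GLof {A : TopAlg.{u} k} (x : GLType A) : ∃ m g, GLof m A g = x := by
  obtain ⟨m, g, h⟩ := DirectLimit.exists_eq_mk (fun _ _ h => stabGL A h) x
  exact ⟨m, g, h.symm⟩

theorem exists_GLof₂ {A : TopAlg.{u} k} (x y : GLType A) :
    ∃ m g g', GLof m A g = x ∧ GLof m A g' = y := by
  obtain ⟨m, g, rfl⟩ := exists_GLof x
  obtain ⟨n, g', rfl⟩ := exists_GLof y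
  exact ⟨max m n, stabGL A (le_max_left _ _) g, stabGL A (le_max_right _ _) g',
    GLof_stabGL _ _, GLof_stabGL _ _⟩

/-- The homomorphism `GL_m(A) → GL_m(B)` induced by `A → B`. -/
def GLmMap (m : ℕ) {A B : TopAlg.{u} k} (φ : A ⟶ B) : GLm m A →* GLm m B :=
  ((unitsMap m (plusMap φ)).comp (GLm m A).subtype).codRestrict (GLm m B)
    fun g => mem_GLm.2 <| by
      change (g.1.val.map (plusMap φ)).map (plusFst B) = 1
      rw [← mem_GLm.1 g.2]
      ext a b
      exact plusFst_plusMap φ _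

theorem GLmMap_val (m : ℕ) {A B : TopAlg.{u} k} (φ : A ⟶ B) (g : GLm m A) :
    (GLmMap m φ g).1.val = g.1.val.map (plusMap φ) := rfl

theorem stabGL_GLmMap {A B : TopAlg.{u} k} (φ : A ⟶ B) {m n : ℕ} (h : m ≤ n) (g : GLm m A) :
    stabGL B h (GLmMap m φ g) = GLmMap n φ (stabGL A h g) :=
  GLm_ext (stab_map _ _)

/-- The function underlying `GLMap`. -/
def GLMapFun {A B : TopAlg.{u} k} (φ : A ⟶ B) : GLType A → GLType B :=
  DirectLimit.lift (fun _ _ h => stabGL A h) (fun m g => GLof m B (GLmMap m φ g))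
    fun m n h g => by rw [← GLof_stabGL h, stabGL_GLmMap]

theorem GLMapFun_of {A B : TopAlg.{u} k} (φ : A ⟶ B) (m : ℕ) (g : GLm m A) :
    GLMapFun φ (GLof m A g) = GLof m B (GLmMap m φ g) := rfl

/-- The homomorphism `GL(A) → GL(B)` induced by `A → B`. -/
def GLMap {A B : TopAlg.{u} k} (φ : A ⟶ B) : GLType A →* GLType B :=
  MonoidHom.mk' (GLMapFun φ) fun x y => by
    obtain ⟨m, g, g', rfl, rfl⟩ := exists_GLof₂ x y
    rw [← map_mul, GLMapFun_of, GLMapFun_of, GLMapFun_of, map_mul, map_mul]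

theorem GLMap_of {A B : TopAlg.{u} k} (φ : A ⟶ B) (m : ℕ) (g : GLm m A) :
    GLMap φ (GLof m A g) = GLof m B (GLmMap m φ g) := rfl

theorem GLMap_id (A : TopAlg.{u} k) (x : GLType A) : GLMap (𝟙 A) x = x := by
  obtain ⟨m, g, rfl⟩ := exists_GLof x
  have h : GLmMap m (𝟙 A) g = g := GLm_ext <| by
    rw [GLmMap_val, plusMap_id]
    ext a b <;> rfl
  rw [GLMap_of, h]

theorem GLMap_comp {A B C : TopAlg.{u} k} (φ : A ⟶ B) (ψ : B ⟶ C) (x : GLType A) :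
    GLMap (φ ≫ ψ) x = GLMap ψ (GLMap φ x) := by
  obtain ⟨m, g, rfl⟩ := exists_GLof x
  have h : GLmMap m (φ ≫ ψ) g = GLmMap m ψ (GLmMap m φ g) := GLm_ext <| by
    rw [GLmMap_val, GLmMap_val, GLmMap_val, plusMap_comp]
    ext a b <;> rfl
  rw [GLMap_of, GLMap_of, GLMap_of, h]

variable (k) in
/-- The general linear group functor `A ↦ GL(A)`. -/
def GLFunctor : TopAlg.{u} k ⥤ GrpCat.{u} where
  obj A := GrpCat.of (GLType A)
  map φ := GrpCat.ofHom (GLMap φ)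
  map_id A := GrpCat.hom_ext (MonoidHom.ext fun x => GLMap_id A x)
  map_comp φ ψ := GrpCat.hom_ext (MonoidHom.ext fun x => GLMap_comp φ ψ x)

theorem plusMap_injective {A B : TopAlg.{u} k} {φ : A ⟶ B}
    (hφ : Function.Injective φ.toFun) : Function.Injective (plusMap φ) := fun x y h =>
  Unitization.ext (by rw [← plusMap_fst φ x, h, plusMap_fst])
    (hφ (by rw [← plusMap_snd φ x, h, plusMap_snd]))

theorem GLMap_injective {A B : TopAlg.{u} k} {φ : A ⟶ B}
    (hφ : Function.Injective φ.toFun) : Function.Injective (GLMap φ) := by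
  intro x y h
  obtain ⟨m, x, y, rfl, rfl⟩ := exists_GLof₂ x y
  rw [GLMap_of, GLMap_of, GLof_eq_iff] at h
  obtain ⟨n, h1, h2, h⟩ := h
  rw [stabGL_GLmMap, stabGL_GLmMap] at h
  refine GLof_eq_iff.2 ⟨n, h1, h2, GLm_ext ?_⟩
  exact Matrix.map_injective (plusMap_injective hφ) (congrArg (fun g => g.1.val) h)

/-- `GL` preserves kernels. -/
theorem exists_GLMap_ker {A B : TopAlg.{u} k} (φ : A ⟶ B) (ι : TopAlg.of k (kerSubalgebra φ) ⟶ A)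
    (hι : ∀ x, ι.toFun x = x.1) (x : GLType A) (hx : GLMap φ x = 1) :
    ∃ w, GLMap ι w = x := by
  obtain ⟨m, g, rfl⟩ := exists_GLof x
  rw [GLMap_of, ← map_one (GLof m B), GLof_eq_iff] at hx
  obtain ⟨n, h, _, hg⟩ := hx
  rw [stabGL_GLmMap, map_one] at hg
  rw [← GLof_stabGL h]
  generalize stabGL A h g = g at hg
  have key : ∀ g : GLm n A, GLmMap n φ g = 1 →
      ∃ M : Matrix (Fin n) (Fin n) (Plus (TopAlg.of k (kerSubalgebra φ))),
        M.map (plusMap ι) = g.1.val := fun g hg => by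
    have h0 : ∀ a b, φ.toFun (g.1.val a b).snd = 0 := fun a b => by
      have h1 : plusMap φ (g.1.val a b) = (1 : Matrix (Fin n) (Fin n) (Plus B)) a b :=
        congrArg (fun g : GLm n B => g.1.val a b) hg
      rw [← plusMap_snd, h1, Matrix.one_apply]
      split_ifs <;> simp
    refine ⟨Matrix.of fun a b => Unitization.inl (g.1.val a b).fst +
      Unitization.inr ⟨(g.1.val a b).snd, h0 a b⟩, ?_⟩
    ext a b
    · rw [Matrix.map_apply, plusMap_fst]; simp
    · rw [Matrix.map_apply, plusMap_snd, hι]; simp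
  have hinj : Function.Injective (plusMap ι) :=
    plusMap_injective fun x y hxy => Subtype.ext (by rw [← hι, ← hι, hxy])
  obtain ⟨M, hM⟩ := key g hg
  obtain ⟨N, hN⟩ := key g⁻¹ (by rw [map_inv, hg, inv_one])
  have hMN : M * N = 1 := Matrix.map_injective hinj <| by
    beta_reduce
    rw [Matrix.map_mul, hM, hN, Matrix.map_one _ (map_zero _) (map_one _)]
    exact g.1.mul_inv
  have hNM : N * M = 1 := Matrix.map_injective hinj <| by
    beta_reduce
    rw [Matrix.map_mul, hM, hN, Matrix.map_one _ (map_zero _) (map_one _)]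
    exact g.1.inv_mul
  refine ⟨GLof n _ ⟨⟨M, N, hMN, hNM⟩, mem_GLm.2 ?_⟩, ?_⟩
  · rw [← mem_GLm.1 g.2, ← hM]
    ext a b
    exact (plusFst_plusMap ι _).symm
  · rw [GLMap_of]
    exact congrArg (GLof n A) (GLm_ext hM)

end GeneralLinear

/-! ### Augmented simplicial groups and their homotopy groups -/

section Homotopy

/-- The face structure of an augmented simplicial group. `X (n + 1)` is the group in simplicial
degree `n` and `X 0` is the group in degree `-1`. Homotopy groups of simplicial groups are computed
from the faces alone (Moore complex), so the degeneracies are not recorded. -/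
structure AugGrp : Type (u + 1) where
  X : ℕ → GrpCat.{u}
  d : ∀ n : ℕ, Fin (n + 1) → (X (n + 1) ⟶ X n)
  d_comp_d : ∀ (n : ℕ) (i j : Fin (n + 1)), i ≤ j →
    d (n + 1) j.succ ≫ d n i = d (n + 1) i.castSucc ≫ d n j
  /-- the Moore boundaries are normal -/
  normal : ∀ n : ℕ,
    ((⨅ i : Fin n, (d n i.succ).hom.ker).map (d n 0).hom).Normal

namespace AugGrp

/-- Moore cycles: the elements killed by all faces. -/
def cycles (G : AugGrp.{u}) : ∀ n : ℕ, Subgroup (G.X n)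
  | 0 => ⊤
  | n + 1 => ⨅ i : Fin (n + 1), (G.d n i).hom.ker

/-- Moore boundaries: the elements `d_0 y` with `d_i y = 1` for all `i > 0`. -/
def boundaries (G : AugGrp.{u}) (n : ℕ) : Subgroup (G.X n) :=
  (⨅ i : Fin n, (G.d n i.succ).hom.ker).map (G.d n 0).hom

instance (G : AugGrp.{u}) (n : ℕ) : (G.boundaries n).Normal := G.normal n

/-- Morphisms of augmented simplicial groups. -/
@[ext]
structure Hom (G H : AugGrp.{u}) where
  f : ∀ n : ℕ, G.X n ⟶ H.X n
  comm : ∀ (n : ℕ) (i : Fin (n + 1)), f (n + 1) ≫ H.d n i = G.d n i ≫ f n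

instance : Category AugGrp.{u} where
  Hom G H := Hom G H
  id G := ⟨fun n => 𝟙 (G.X n), fun n i => by rw [Category.id_comp, Category.comp_id]⟩
  comp a b := ⟨fun n => a.f n ≫ b.f n, fun n i => by
    rw [Category.assoc, b.comm, ← Category.assoc, a.comm, Category.assoc]⟩

theorem Hom.comm_apply {G H : AugGrp.{u}} (a : Hom G H) (n : ℕ) (i : Fin (n + 1))
    (x : G.X (n + 1)) : (H.d n i).hom ((a.f (n + 1)).hom x) = (a.f n).hom ((G.d n i).hom x) :=
  congrArg (fun φ => GrpCat.Hom.hom φ x) (a.comm n i)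

theorem Hom.map_cycles {G H : AugGrp.{u}} (a : Hom G H) (n : ℕ) :
    G.cycles n ≤ (H.cycles n).comap (a.f n).hom := by
  intro x hx
  cases n with
  | zero => exact Subgroup.mem_top _
  | succ n =>
    refine Subgroup.mem_iInf.2 fun i => ?_
    have h : (G.d n i).hom x = 1 := Subgroup.mem_iInf.1 hx i
    rw [MonoidHom.mem_ker, a.comm_apply, h, map_one]

theorem Hom.map_boundaries {G H : AugGrp.{u}} (a : Hom G H) (n : ℕ) :
    G.boundaries n ≤ (H.boundaries n).comap (a.f n).hom := by
  rintro _ ⟨y, hy, rfl⟩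
  refine ⟨(a.f (n + 1)).hom y, Subgroup.mem_iInf.2 fun i => ?_, a.comm_apply n 0 y⟩
  have h : (G.d n i.succ).hom y = 1 := Subgroup.mem_iInf.1 hy i
  rw [MonoidHom.mem_ker, a.comm_apply, h, map_one]

/-- The homomorphism of cycles induced by a morphism. -/
def Hom.cyclesMap {G H : AugGrp.{u}} (a : Hom G H) (n : ℕ) : G.cycles n →* H.cycles n :=
  ((a.f n).hom.comp (G.cycles n).subtype).codRestrict (H.cycles n) fun x => a.map_cycles n x.2

/-- The homotopy group `π_{n-1}` of an augmented simplicial group, `n ≥ 0`: cycles modulo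
boundaries. In particular `π_{-1}` is the cokernel of the augmentation `G₀ → G₋₁`, and `π_0` of the
augmented simplicial group is the kernel of `π_0(G_*) → G₋₁`. -/
def π (n : ℕ) : AugGrp.{u} ⥤ GrpCat.{u} where
  obj G := GrpCat.of (G.cycles n ⧸ (G.boundaries n).subgroupOf (G.cycles n))
  map {G H} a := GrpCat.ofHom (QuotientGroup.map _ _ (Hom.cyclesMap a n)
    fun _ hx => Hom.map_boundaries a n hx)
  map_id G := GrpCat.hom_ext <| MonoidHom.ext fun x => by
    induction x using QuotientGroup.induction_on with
    | H x => rfl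
  map_comp a b := GrpCat.hom_ext <| MonoidHom.ext fun x => by
    induction x using QuotientGroup.induction_on with
    | H x => rfl

end AugGrp

variable {k : Type} [RCLike k]

theorem GLMap_eq_one {A B : TopAlg.{u} k} {φ : A ⟶ B} (hφ : ∀ a, φ.toFun a = 0)
    (x : GLType A) : GLMap φ x = 1 := by
  obtain ⟨m, g, rfl⟩ := exists_GLof x
  have h : GLmMap m φ g = 1 := GLm_ext <| by
    have h1 := mem_GLm.1 g.2
    have h2 : ∀ a b, (g.1.val a b).fst = (1 : Matrix (Fin m) (Fin m) k) a b := fun a b =>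
      congrArg (fun M : Matrix (Fin m) (Fin m) k => M a b) h1
    rw [GLmMap_val]
    change _ = (1 : Matrix (Fin m) (Fin m) (Plus B))
    ext a b
    · rw [Matrix.map_apply, plusMap_fst, h2, Matrix.one_apply, Matrix.one_apply]
      split_ifs <;> rfl
    · rw [Matrix.map_apply, plusMap_snd, hφ, Matrix.one_apply]
      split_ifs <;> rfl
  rw [GLMap_of, h, map_one]

namespace PathFunctor

variable (P : PathFunctor.{u} k)

theorem exists_conj {B : TopAlg.{u} k} (y : GLType (P.ker.obj B)) (z : GLType B) :
    ∃ w : GLType (P.ker.obj B),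
      GLMap (B := B) (P.τ.app B) w = z * GLMap (B := B) (P.τ.app B) y * z⁻¹ ∧
      ∀ (C : TopAlg.{u} k) (d : B ⟶ C), GLMap (P.ker.map d) y = 1 → GLMap (P.ker.map d) w = 1 := by
  have hc : ∀ (e : P.paths ⟶ 𝟭 _), P.const ≫ e = 𝟙 _ →
      GLMap (e.app B) (GLMap (P.const.app B) z) = z := fun e he => by
    have : P.const.app B ≫ e.app B = 𝟙 B := congrArg (fun α => NatTrans.app α B) he
    exact (GLMap_comp (P.const.app B) (e.app B) z).symm.trans
      ((congrArg (fun φ => GLMap φ z) this).trans (GLMap_id _ _))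
  have hι₀ : GLMap (P.ev₀.app B) (GLMap (P.ι.app B) y) = 1 :=
    (GLMap_comp (P.ι.app B) (P.ev₀.app B) y).symm.trans
      (GLMap_eq_one (φ := P.ι.app B ≫ P.ev₀.app B)
        (fun a : kerSubalgebra (P.ev₀.app B) => a.2) y)
  obtain ⟨w, hw⟩ : ∃ w : GLType (P.ker.obj B), GLMap (P.ι.app B) w =
      GLMap (P.const.app B) z * GLMap (P.ι.app B) y * (GLMap (P.const.app B) z)⁻¹ :=
    exists_GLMap_ker (P.ev₀.app B) (P.ι.app B) (fun _ => rfl) _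
      (by rw [map_mul, map_mul, hι₀, mul_one, ← map_mul, mul_inv_cancel, map_one])
  have hτ : ∀ y, GLMap (P.τ.app B) y = GLMap (P.ev₁.app B) (GLMap (P.ι.app B) y) := fun y =>
    GLMap_comp (P.ι.app B) (P.ev₁.app B) y
  refine ⟨w, ?_, fun C d hy => ?_⟩
  · rw [hτ, hτ, hw, map_mul, map_mul, map_inv, hc P.ev₁ P.const_ev₁]
  · have hd : ∀ y, GLMap (P.ι.app C) (GLMap (P.ker.map d) y) =
        GLMap (P.paths.map d) (GLMap (P.ι.app B) y) := fun y =>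
      (GLMap_comp (P.ker.map d) (P.ι.app C) y).symm.trans
        ((congrArg (fun φ => GLMap φ y) (P.ι.naturality d)).trans
          (GLMap_comp (P.ι.app B) (P.paths.map d) y))
    have hinj : Function.Injective (GLMap (P.ι.app C)) :=
      GLMap_injective (φ := P.ι.app C) Subtype.val_injective
    refine hinj ?_
    rw [hd, hw, map_mul, map_mul, ← hd, hy, map_one, mul_one, ← map_mul, mul_inv_cancel,
      map_one]

theorem boundaries_normal (n : ℕ) (A : TopAlg.{u} k) :
    ((⨅ i : Fin n, (GLMap ((P.face n i.succ).app A)).ker).map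
      (GLMap ((P.face n 0).app A))).Normal := by
  refine ⟨?_⟩
  rintro _ ⟨y, hy, rfl⟩ z
  obtain ⟨w, hw, hw'⟩ := P.exists_conj (B := (P.iter n).obj A) y z
  refine ⟨w, Subgroup.mem_iInf.2 fun i => ?_, ?_⟩
  · have hyi : GLMap ((P.face n i.succ).app A) y = 1 := Subgroup.mem_iInf.1 hy i
    cases n with
    | zero => exact i.elim0
    | succ n => exact hw' _ ((P.face n i).app A) hyi
  · rw [face_zero]
    exact hw

/-- The augmented simplicial group `GL(P_*^+(A))`, as a functor of `A`. -/
def augGL : TopAlg.{u} k ⥤ AugGrp.{u} where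
  obj A :=
    { X := fun n => (GLFunctor k).obj ((P.iter n).obj A)
      d := fun n i => (GLFunctor k).map ((P.face n i).app A)
      d_comp_d := fun n i j hij => by
        rw [← Functor.map_comp, ← Functor.map_comp, P.face_face n i j hij A]
      normal := fun n => P.boundaries_normal n A }
  map {A B} φ :=
    { f := fun n => (GLFunctor k).map ((P.iter n).map φ)
      comm := fun n i => by
        rw [← Functor.map_comp, ← Functor.map_comp, (P.face n i).naturality φ] }
  map_id A := AugGrp.Hom.ext <| funext fun n => by
    change (GLFunctor k).map ((P.iter n).map (𝟙 A)) = 𝟙 _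
    rw [CategoryTheory.Functor.map_id, CategoryTheory.Functor.map_id]
  map_comp φ ψ := AugGrp.Hom.ext <| funext fun n => by
    change (GLFunctor k).map ((P.iter n).map (φ ≫ ψ)) =
      (GLFunctor k).map ((P.iter n).map φ) ≫ (GLFunctor k).map ((P.iter n).map ψ)
    rw [Functor.map_comp, Functor.map_comp]

variable {P} {Q : PathFunctor.{u} k}

/-- The morphism of augmented simplicial groups induced by a morphism of path functors. -/
def Hom.augGL (f : Hom k P Q) : P.augGL ⟶ Q.augGL where
  app A :=
    { f := fun n => (GLFunctor k).map ((f.iter n).app A)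
      comm := fun n i => ((GLFunctor k).map_comp _ _).symm.trans
        ((congrArg (GLFunctor k).map (f.iter_face n i A)).trans ((GLFunctor k).map_comp _ _)) }
  naturality _ _ φ := AugGrp.Hom.ext <| funext fun n =>
    ((GLFunctor k).map_comp _ _).symm.trans
      ((congrArg (GLFunctor k).map ((f.iter n).naturality φ)).trans ((GLFunctor k).map_comp _ _))

end PathFunctor

end Homotopy

/-! ### The Grothendieck group -/

section KZero

/-- Idempotent matrices over `R`; `p` represents the finitely generated projective module given by
the image of `p`. -/
@[ext]
structure Idem (R : Type*) [Ring R] where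
  size : ℕ
  mat : Matrix (Fin size) (Fin size) R
  idem : mat * mat = mat

namespace Idem

variable {R S T : Type*} [Ring R] [Ring S] [Ring T]

/-- Two idempotent matrices are equivalent if their images are isomorphic as modules. -/
def Equiv (p q : Idem R) : Prop :=
  ∃ (x : Matrix (Fin p.size) (Fin q.size) R) (y : Matrix (Fin q.size) (Fin p.size) R),
    x * y = p.mat ∧ y * x = q.mat

/-- The block sum of idempotent matrices. -/
def add (p q : Idem R) : Idem R where
  size := p.size + q.size
  mat := (Matrix.fromBlocks p.mat 0 0 q.mat).submatrix finSumFinEquiv.symm finSumFinEquiv.symm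
  idem := by
    rw [Matrix.submatrix_mul_equiv, Matrix.fromBlocks_multiply]
    simp [p.idem, q.idem]

/-- The idempotent matrix obtained by applying a ring homomorphism to the entries. -/
def map (φ : R →+* S) (p : Idem R) : Idem S where
  size := p.size
  mat := p.mat.map φ
  idem := by rw [← Matrix.map_mul, p.idem]

theorem Equiv.map (φ : R →+* S) {p q : Idem R} (h : Equiv p q) : Equiv (p.map φ) (q.map φ) := by
  obtain ⟨x, y, h1, h2⟩ := h
  exact ⟨x.map φ, y.map φ, Matrix.map_mul.symm.trans (congrArg (fun M => Matrix.map M φ) h1),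
    Matrix.map_mul.symm.trans (congrArg (fun M => Matrix.map M φ) h2)⟩

theorem map_add (φ : R →+* S) (p q : Idem R) : (p.add q).map φ = (p.map φ).add (q.map φ) := by
  have h0 : (Matrix.fromBlocks p.mat 0 0 q.mat).map φ =
      Matrix.fromBlocks (p.mat.map φ) 0 0 (q.mat.map φ) := by
    rw [Matrix.fromBlocks_map]; simp
  have h : ((p.add q).map φ).mat = ((p.map φ).add (q.map φ)).mat :=
    congrArg (fun M => Matrix.submatrix M finSumFinEquiv.symm finSumFinEquiv.symm) h0
  exact Idem.ext rfl (heq_of_eq h)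

end Idem

variable {R S T : Type*} [Ring R] [Ring S] [Ring T]

/-- The relations of `K₀(R)`. -/
def kZeroRel (R : Type*) [Ring R] : AddSubgroup (FreeAbelianGroup (Idem R)) :=
  AddSubgroup.closure
    ({x | ∃ p q, Idem.Equiv p q ∧ x = FreeAbelianGroup.of p - FreeAbelianGroup.of q} ∪
      {x | ∃ p q, x = FreeAbelianGroup.of (Idem.add p q) -
        (FreeAbelianGroup.of p + FreeAbelianGroup.of q)})

/-- `K₀(R)` of a unital ring: the Grothendieck group of the monoid of isomorphism classes of finitely
generated projective modules. -/
def KZeroUnital (R : Type*) [Ring R] : Type _ := FreeAbelianGroup (Idem R) ⧸ kZeroRel R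

instance : AddCommGroup (KZeroUnital R) :=
  inferInstanceAs (AddCommGroup (FreeAbelianGroup (Idem R) ⧸ kZeroRel R))

theorem kZeroRel_map (φ : R →+* S) :
    kZeroRel R ≤ (kZeroRel S).comap (FreeAbelianGroup.map (Idem.map φ)) := by
  refine (AddSubgroup.closure_le _).2 ?_
  rintro _ (⟨p, q, h, rfl⟩ | ⟨p, q, rfl⟩)
  · refine AddSubgroup.subset_closure (Or.inl ⟨p.map φ, q.map φ, h.map φ, ?_⟩)
    simp
  · refine AddSubgroup.subset_closure (Or.inr ⟨p.map φ, q.map φ, ?_⟩)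
    simp [Idem.map_add]

/-- The homomorphism `K₀(R) → K₀(S)` induced by a unital ring homomorphism. -/
def KZeroUnital.map (φ : R →+* S) : KZeroUnital R →+ KZeroUnital S :=
  QuotientAddGroup.map _ _ (FreeAbelianGroup.map (Idem.map φ)) (kZeroRel_map φ)

theorem KZeroUnital.map_map (φ : R →+* S) (ψ : S →+* T) (x : KZeroUnital R) :
    map ψ (map φ x) = map (ψ.comp φ) x := by
  obtain ⟨x, rfl⟩ := QuotientAddGroup.mk_surjective x
  refine congrArg (QuotientAddGroup.mk (s := kZeroRel T)) ?_
  exact (FreeAbelianGroup.map_comp_apply (f := Idem.map φ) (g := Idem.map ψ) x).symm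

theorem KZeroUnital.map_id (x : KZeroUnital R) : map (RingHom.id R) x = x := by
  obtain ⟨x, rfl⟩ := QuotientAddGroup.mk_surjective x
  exact congrArg (QuotientAddGroup.mk (s := kZeroRel R)) (FreeAbelianGroup.map_id_apply x)

variable {k : Type} [RCLike k]

/-- `K₀(A)` of a non-unital algebra: the kernel of `K₀(A⁺) → K₀(k)`. -/
def kZeroKer (A : TopAlg.{u} k) : AddSubgroup (KZeroUnital (Plus A)) :=
  (KZeroUnital.map (plusFst A)).ker

/-- The homomorphism `K₀(A) → K₀(B)` induced by `A → B`. -/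
def kZeroMap {A B : TopAlg.{u} k} (φ : A ⟶ B) : kZeroKer A →+ kZeroKer B :=
  ((KZeroUnital.map (plusMap φ)).comp (kZeroKer A).subtype).codRestrict (kZeroKer B) fun x => by
    have h : (plusFst B).comp (plusMap φ) = plusFst A := RingHom.ext (plusFst_plusMap φ)
    change KZeroUnital.map (plusFst B) (KZeroUnital.map (plusMap φ) x.1) = 0
    rw [KZeroUnital.map_map, h]
    exact x.2

variable (k) in
/-- The functor `K₀`, written multiplicatively. -/
def KZero : TopAlg.{u} k ⥤ GrpCat.{u} where
  obj A := GrpCat.of (Multiplicative (kZeroKer A))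
  map φ := GrpCat.ofHom (AddMonoidHom.toMultiplicative (kZeroMap φ))
  map_id A := GrpCat.hom_ext <| MonoidHom.ext fun x => Subtype.ext <|
    (congrArg (fun φ => KZeroUnital.map φ (Multiplicative.toAdd x).1) (plusMap_id A)).trans
      (KZeroUnital.map_id _)
  map_comp φ ψ := GrpCat.hom_ext <| MonoidHom.ext fun x => Subtype.ext <|
    (congrArg (fun φ => KZeroUnital.map φ (Multiplicative.toAdd x).1) (plusMap_comp φ ψ)).trans
      (KZeroUnital.map_map _ _ _).symm

end KZero

/-! ### Smooth and topological `K`-functors -/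

section KTheory

variable (k : Type) [RCLike k]

/-- `K_n` with respect to a path functor: `K₀`, and `π_{n-2} GL(P_*^+(A))` for `n ≥ 1`. -/
def KPath (P : PathFunctor.{u} k) : ℕ → (TopAlg.{u} k ⥤ GrpCat.{u})
  | 0 => KZero k
  | n + 1 => P.augGL ⋙ AugGrp.π n

/-- The smooth `K`-functors `K^{sm}_n`. -/
def Ksm (n : ℕ) : TopAlg.{u} k ⥤ GrpCat.{u} := KPath k (smoothPaths k) n

/-- The topological `K`-functors `K^{top}_n`. -/
def Ktop (n : ℕ) : TopAlg.{u} k ⥤ GrpCat.{u} := KPath k (contPaths k) n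

/-- The comparison `β_n : K^{sm}_n → K^{top}_n`, induced for `n ≥ 1` by the inclusion of the smooth
paths into the continuous paths. -/
def beta : ∀ n : ℕ, Ksm.{u} k n ⟶ Ktop k n
  | 0 => 𝟙 (KZero k)
  | n + 1 => Functor.whiskerRight (smoothToCont k).augGL (AugGrp.π n)

/-- The inclusion `A^{I^m} → A^{I^{m+2}}`, induced by the projection `I^{m+2} → I^m` onto the first
`m` coordinates. -/
def cubeIncl (m : ℕ) (A : TopAlg.{u} k) :
    (contMaps k (Fin m → I)).obj A ⟶ (contMaps k (Fin (m + 2) → I)).obj A :=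
  precomp k ⟨fun t j => t (Fin.castAdd 2 j), by fun_prop⟩ A

end KTheory

end SmoothK

end

noncomputable section

namespace SmoothK

variable {k : Type} [RCLike k]

/-! ### Kernels of families of homomorphisms -/

/-! Write `Ω_s` and `Ω_c` for the smooth and the continuous loop functor (paths vanishing at both
ends). `GL` carries kernels of algebras to kernels of groups, so the Moore cycles of the augmented
simplicial group at index `n` form `GL(Ω^n A)`, and the boundaries are the elements joined to `1` by
a path (`isCycles_loopIterIncl`). Hence `K_{n+1}(A)` is the group of path components of `GL(Ω^n A)`,
and the claim is that `GL(Ω_s^i A) → GL(Ω_c^i A)` identifies smooth components with continuous ones.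

The working notion is `Invariant X D`: every element of `GL(D^X)` is smoothly homotopic to a
constant. Because `Ω_s^b (A^X) ≅ (Ω_s^b A)^X`, surjectivity of the maps in the hypotheses makes
`Ω_s^b A` invariant on the cube of dimension `i + 1 - b`, for all `b ≤ i`. This exchange of functors
rests on the mean value inequality, hence on local convexity.

The engine is `bijConn_smoothLoop`: if `D` and `Ω_s D` are invariant on the interval, then `Ω_s D →
Ω_c D` is bijective on smooth components. A continuous loop `b` is an element of `GL(D^I)`, so
invariance joins it to `1` by a smooth path in `GL(D^I)`, a square `h(s, t)` smooth in `s`. Its edge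
`t = 1` is a smooth loop `a`, and dividing by the square `a(st)` leaves a smooth path of continuous
loops from `1` to `b a⁻¹`. A similar square gives injectivity.

Each loop costs one dimension of the cube: `Ω_c^a Ω_s^b A` is invariant on the cube of dimension `i
+ 1 - (a + b)` (`invariant_loopIter`). This suffices to replace smooth loops by continuous ones one
at a time. For `Ω_c^i A` one dimension is left, and it makes the smooth and the continuous
components of `GL(Ω_c^i A)` coincide (`null_cont_le_smooth`). -/

/-- `j` identifies `B`, topology included, with the common kernel of the family `d`. -/
structure IsKer {ι : Type} {B C : TopAlg.{u} k} {D : ι → TopAlg.{u} k} (j : B ⟶ C)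
    (d : ∀ i, C ⟶ D i) : Prop where
  emb : IsEmbedding j.toFun
  map_eq_zero : ∀ b i, (d i).toFun (j.toFun b) = 0
  exists_eq : ∀ c, (∀ i, (d i).toFun c = 0) → ∃ b, j.toFun b = c

namespace IsKer

variable {ι : Type} {B C E : TopAlg.{u} k} {D : ι → TopAlg.{u} k} {j : B ⟶ C} {d : ∀ i, C ⟶ D i}

theorem injective (h : IsKer j d) : Function.Injective j.toFun := h.emb.injective

theorem hom_ext (h : IsKer j d) {f g : E ⟶ B} (hfg : f ≫ j = g ≫ j) : f = g :=
  TopAlg.hom_ext fun a => h.injective (congrArg (fun φ => TopAlg.Hom.toFun φ a) hfg)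

/-- The universal property of the kernel. -/
theorem exists_lift (h : IsKer j d) (f : E ⟶ C) (hf : ∀ i a, (d i).toFun (f.toFun a) = 0) :
    ∃ g : E ⟶ B, g ≫ j = f := by
  choose g hg using fun a => h.exists_eq (f.toFun a) fun i => hf i a
  refine ⟨{ toFun :=
              { toFun := g
                map_smul' := fun c x => h.injective (by
                  rw [hg, MonoidHom.id_apply, map_smul, map_smul, hg])
                map_zero' := h.injective (by rw [hg, map_zero, map_zero])
                map_add' := fun x y => h.injective (by rw [hg, map_add, map_add, hg, hg])
                map_mul' := fun x y => h.injective (by rw [hg, map_mul, map_mul, hg, hg]) }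
            cont := h.emb.isInducing.continuous_iff.2 (f.cont.congr fun a => (hg a).symm) }, ?_⟩
  exact TopAlg.hom_ext hg

/-- Isomorphic kernels: an isomorphism of the ambient algebras that matches the families restricts
to an isomorphism of the kernels. -/
theorem exists_iso (h : IsKer j d) {ι' : Type} {B' C' : TopAlg.{u} k} {D' : ι' → TopAlg.{u} k}
    {j' : B' ⟶ C'} {d' : ∀ i, C' ⟶ D' i} (h' : IsKer j' d') (θ : C ≅ C')
    (hθ : ∀ c, (∀ i, (d i).toFun c = 0) ↔ ∀ i, (d' i).toFun (θ.hom.toFun c) = 0) :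
    ∃ θ' : B ≅ B', θ'.hom ≫ j' = j ≫ θ.hom := by
  have hi : ∀ c, θ.hom.toFun (θ.inv.toFun c) = c := fun c =>
    congrArg (fun φ => TopAlg.Hom.toFun φ c) θ.inv_hom_id
  obtain ⟨f, hf⟩ := h'.exists_lift (j ≫ θ.hom) fun i a =>
    (hθ (j.toFun a)).1 (h.map_eq_zero a) i
  obtain ⟨g, hg⟩ := h.exists_lift (j' ≫ θ.inv) fun i a =>
    (hθ _).2 (fun i => by rw [TopAlg.comp_toFun, hi]; exact h'.map_eq_zero a i) i
  refine ⟨⟨f, g, h.hom_ext ?_, h'.hom_ext ?_⟩, hf⟩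
  · rw [Category.assoc, hg, ← Category.assoc, hf, Category.assoc, θ.hom_inv_id, Category.comp_id,
      Category.id_comp]
  · rw [Category.assoc, hf, ← Category.assoc, hg, Category.assoc, θ.inv_hom_id, Category.comp_id,
      Category.id_comp]

end IsKer

theorem isKer_kerSubalgebra {B C : TopAlg.{u} k} (φ : B ⟶ C)
    (j : TopAlg.of k (kerSubalgebra φ) ⟶ B) (hj : ∀ x, j.toFun x = x.1) :
    IsKer j (fun _ : Unit => φ) where
  emb := by
    have : (j.toFun : TopAlg.of k (kerSubalgebra φ) → B) = Subtype.val := funext hj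
    rw [this]
    exact IsEmbedding.subtypeVal
  map_eq_zero b _ := by rw [hj]; exact b.2
  exists_eq c hc := ⟨⟨c, hc ()⟩, hj _⟩

/-- A functor preserves kernels of families. -/
def PreservesKer (F : TopAlg.{u} k ⥤ TopAlg.{u} k) : Prop :=
  ∀ {ι : Type} {B C : TopAlg.{u} k} {D : ι → TopAlg.{u} k} (j : B ⟶ C) (d : ∀ i, C ⟶ D i),
    IsKer j d → IsKer (F.map j) (fun i => F.map (d i))

theorem PreservesKer.id : PreservesKer (𝟭 (TopAlg.{u} k)) := fun _ _ h => h

theorem PreservesKer.comp {F G : TopAlg.{u} k ⥤ TopAlg.{u} k} (hF : PreservesKer F)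
    (hG : PreservesKer G) : PreservesKer (F ⋙ G) := fun _ _ h => hG _ _ (hF _ _ h)

theorem naturality_toFun {F G : TopAlg.{u} k ⥤ TopAlg.{u} k} (α : F ⟶ G) {B C : TopAlg.{u} k}
    (f : B ⟶ C) (x : F.obj B) :
    (α.app C).toFun ((F.map f).toFun x) = (G.map f).toFun ((α.app B).toFun x) :=
  congrArg (fun φ => TopAlg.Hom.toFun φ x) (α.naturality f)

/-- A functor which is a kernel in a kernel preserving functor preserves kernels. -/
theorem PreservesKer.of_isKer {F F' : TopAlg.{u} k ⥤ TopAlg.{u} k} (hF : PreservesKer F)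
    {κ : Type} (α : F' ⟶ F) (e : κ → (F ⟶ 𝟭 _))
    (h : ∀ A, IsKer (α.app A) (fun i => (e i).app A)) : PreservesKer F' := by
  intro ι B C D j d hj
  refine ⟨?_, fun b i => ?_, fun c hc => ?_⟩
  · refine IsEmbedding.of_comp (F'.map j).cont (α.app C).cont ?_
    have : (α.app C).toFun ∘ (F'.map j).toFun = (F.map j).toFun ∘ (α.app B).toFun :=
      funext (naturality_toFun α j)
    rw [this]
    exact (hF _ _ hj).emb.comp (h B).emb
  · refine (h (D i)).injective ?_
    rw [naturality_toFun, naturality_toFun, (hF _ _ hj).map_eq_zero, map_zero]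
  · obtain ⟨b, hb⟩ := (hF _ _ hj).exists_eq ((α.app C).toFun c) fun i => by
      rw [← naturality_toFun, hc, map_zero]
    -- The condition `e i` on `b` lives in `B`; it is tested after the injection `j`, where
    -- naturality turns it into the condition on the image of `c`.
    obtain ⟨a, rfl⟩ := (h B).exists_eq b fun i => hj.injective <| by
      rw [map_zero]
      refine (naturality_toFun (e i) j b).symm.trans ?_
      rw [hb, (h C).map_eq_zero]
    exact ⟨a, (h C).injective (by rw [naturality_toFun, hb])⟩

/-- A map into `C` with values in the kernel lifts pointwise, and the lift is continuous because `j`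
is an embedding. -/
theorem preservesKer_contMaps (X : Type) [TopologicalSpace X] [LocallyCompactSpace X] :
    PreservesKer (contMaps.{u} k X) := by
  intro ι B C D j d hj
  refine ⟨ContinuousMap.isEmbedding_postcomp ⟨j.toFun, j.cont⟩ hj.emb, fun b i => ?_,
    fun c hc => ?_⟩
  · exact ContinuousMap.ext fun x => hj.map_eq_zero (ContinuousMap.toFun (X := X) (Y := B) b x) i
  · choose g hg using fun x => hj.exists_eq (ContinuousMap.toFun (X := X) (Y := C) c x)
      fun i => congrArg (fun f : C(X, D i) => f x) (hc i)
    exact ⟨(⟨g, hj.emb.isInducing.continuous_iff.2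
      ((ContinuousMap.continuous_toFun (X := X) (Y := C) c).congr fun x => (hg x).symm)⟩ : C(X, B)),
      ContinuousMap.ext hg⟩

theorem SmoothPath.jet_hasPathDeriv {A : TopAlg.{u} k} (f : SmoothPath A) (n : ℕ) (t : I) :
    HasPathDeriv k (jet A f n) (jet A f (n + 1) t) t := by
  have h := hasPathDeriv ((deriv A ^ n) f) t
  rw [jet_apply, jet_apply, pow_succ']
  exact h

/-- The smooth path with a given sequence of derivatives. -/
theorem SmoothPath.exists_jet_eq {A : TopAlg.{u} k} (g : ℕ → C(I, A))
    (hg : ∀ n t, HasPathDeriv k (g n) (g (n + 1) t) t) : ∃ f : SmoothPath A, jet A f = g := by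
  refine ⟨⟨g 0, g, rfl, hg⟩, funext fun n => ?_⟩
  -- The jet is built from chosen derivatives; uniqueness of limits identifies them with `g`.
  induction n with
  | zero => rfl
  | succ n ih =>
    refine ContinuousMap.ext fun t => ?_
    have h := jet_hasPathDeriv (A := A) ⟨g 0, g, rfl, hg⟩ n t
    rw [ih] at h
    exact h.unique (hg n t)

/-- If a smooth path is killed by all `d i`, so are its derivatives; hence the whole jet lifts. The
difference quotients of the lifts converge in `B` because they do in `C` and `j` is inducing. -/
theorem preservesKer_smoothMaps : PreservesKer (smoothMaps.{u} k) := by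
  intro ι B C D j d hj
  have hc := preservesKer_contMaps I j d hj
  have hjet : ∀ f : SmoothPath B, ∀ n, SmoothPath.jet C (SmoothPath.mapFun k j f) n =
    ((contMaps k I).map j).toFun (SmoothPath.jet B f n) := fun f n => SmoothPath.jet_mapFun k j n f
  refine ⟨⟨?_, ?_⟩, fun b i => ?_, fun c hc' => ?_⟩
  · have hi : IsInducing (SmoothPath.jet C) := ⟨rfl⟩
    refine (IsInducing.of_comp_iff hi).1 ?_
    have : (SmoothPath.jet C) ∘ ((smoothMaps k).map j).toFun =
        (fun g : ℕ → C(I, B) => fun n => (((contMaps k I).map j).toFun (g n) : C(I, C))) ∘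
          (SmoothPath.jet B) := funext fun f => funext (hjet f)
    rw [this]
    refine IsInducing.comp ?_ ⟨rfl⟩
    exact IsInducing.piMap fun _ => hc.emb.isInducing
  · intro x y hxy
    refine SmoothPath.jet_injective (funext fun n => hc.injective ?_)
    exact (hjet x n).symm.trans ((congrArg (fun z => SmoothPath.jet C z n) hxy).trans (hjet y n))
  · exact SmoothPath.incl_injective (hc.map_eq_zero (SmoothPath.incl B b) i)
  · choose g hg using fun n => hc.exists_eq (SmoothPath.jet C c n) fun i => by
      refine (SmoothPath.jet_mapFun k (d i) n c).symm.trans ?_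
      exact (congrArg (fun z => SmoothPath.jet (D i) z n) (hc' i)).trans
        (congrFun (map_zero (SmoothPath.jet (D i))) n)
    obtain ⟨f, hf⟩ := SmoothPath.exists_jet_eq (A := B) g fun n t => by
      refine hj.emb.isInducing.tendsto_nhds_iff.2 ?_
      have h := SmoothPath.jet_hasPathDeriv c n t
      rw [← hg, ← hg] at h
      refine h.congr fun s => ?_
      exact ((map_smul j.toFun _ _).trans (congrArg _ (map_sub j.toFun _ _))).symm
    refine ⟨f, SmoothPath.jet_injective (funext fun n => ?_)⟩
    exact (hjet f n).trans (by rw [hf, hg])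

/-! ### The general linear group and kernels -/

theorem stab_injective {R : Type*} [Ring R] {m n : ℕ} (h : m ≤ n) :
    Function.Injective (stab : Matrix (Fin m) (Fin m) R → Matrix (Fin n) (Fin n) R) := by
  intro M N hMN
  ext a b
  have := congrFun (congrFun hMN (Fin.castLE h a)) (Fin.castLE h b)
  simpa [stab] using this

theorem GLof_injective (m : ℕ) (A : TopAlg.{u} k) : Function.Injective (GLof m A) := by
  intro x y h
  obtain ⟨p, hm, _, h⟩ := GLof_eq_iff.1 h
  exact GLm_ext (stab_injective hm (congrArg (fun g => g.1.val) h))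

/-- Stabilization is injective, so triviality can be read off from one representing matrix; its
scalar part is the identity already. -/
theorem GLMap_of_eq_one_iff {A B : TopAlg.{u} k} (φ : A ⟶ B) {m : ℕ} (g : GLm m A) :
    GLMap φ (GLof m A g) = 1 ↔ ∀ a b, φ.toFun (g.1.val a b).snd = 0 := by
  rw [GLMap_of, ← map_one (GLof m B), (GLof_injective m B).eq_iff]
  refine ⟨fun h a b => ?_, fun h => GLm_ext ?_⟩
  · have h1 : plusMap φ (g.1.val a b) = (1 : Matrix (Fin m) (Fin m) (Plus B)) a b :=
      congrArg (fun g : GLm m B => g.1.val a b) h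
    rw [← plusMap_snd, h1, Matrix.one_apply]
    split_ifs <;> simp
  · have h2 : ∀ a b, (g.1.val a b).fst = (1 : Matrix (Fin m) (Fin m) k) a b := fun a b =>
      congrArg (fun M : Matrix (Fin m) (Fin m) k => M a b) (mem_GLm.1 g.2)
    rw [GLmMap_val]
    change _ = (1 : Matrix (Fin m) (Fin m) (Plus B))
    ext a b
    · rw [Matrix.map_apply, plusMap_fst, h2, Matrix.one_apply, Matrix.one_apply]
      split_ifs <;> rfl
    · rw [Matrix.map_apply, plusMap_snd, h, Matrix.one_apply]
      split_ifs <;> rfl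

/-! ### The general linear group of a common kernel -/

section

variable {ι : Type} {B C : TopAlg.{u} k} {D : ι → TopAlg.{u} k} {j : B ⟶ C} {d : ∀ i, C ⟶ D i}

theorem IsKer.GLMap_injective (h : IsKer j d) : Function.Injective (GLMap j) :=
  SmoothK.GLMap_injective h.injective

theorem IsKer.GLMap_eq_one (h : IsKer j d) (x : GLType B) (i : ι) :
    GLMap (d i) (GLMap j x) = 1 := by
  rw [← GLMap_comp]
  exact SmoothK.GLMap_eq_one (φ := j ≫ d i) (fun a => h.map_eq_zero a i) x

/-- The matrix and its inverse both have entries that lift to `B⁺`, and injectivity of `B⁺ → C⁺`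
shows that the lifts are again inverse to each other. -/
theorem IsKer.exists_GLMap_eq (h : IsKer j d) (x : GLType C) (hx : ∀ i, GLMap (d i) x = 1) :
    ∃ w, GLMap j w = x := by
  obtain ⟨m, g, rfl⟩ := exists_GLof x
  have key : ∀ g : GLm m C, (∀ i, GLMap (d i) (GLof m C g) = 1) →
      ∃ M : Matrix (Fin m) (Fin m) (Plus B), M.map (plusMap j) = g.1.val := fun g hg => by
    choose b hb using fun p q => h.exists_eq (g.1.val p q).snd
      fun i => (GLMap_of_eq_one_iff (d i) g).1 (hg i) p q
    refine ⟨Matrix.of fun p q => Unitization.inl (g.1.val p q).fst + Unitization.inr (b p q), ?_⟩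
    ext p q
    · rw [Matrix.map_apply, plusMap_fst]; simp
    · rw [Matrix.map_apply, plusMap_snd]; simp [hb]
  have hinj : Function.Injective (plusMap j) := plusMap_injective h.injective
  obtain ⟨M, hM⟩ := key g hx
  obtain ⟨N, hN⟩ := key g⁻¹ fun i => by rw [map_inv, map_inv, hx, inv_one]
  have hMN : M * N = 1 := Matrix.map_injective hinj <| by
    beta_reduce
    rw [Matrix.map_mul, hM, hN, Matrix.map_one _ (map_zero _) (map_one _)]
    exact g.1.mul_inv
  have hNM : N * M = 1 := Matrix.map_injective hinj <| by
    beta_reduce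
    rw [Matrix.map_mul, hM, hN, Matrix.map_one _ (map_zero _) (map_one _)]
    exact g.1.inv_mul
  refine ⟨GLof m _ ⟨⟨M, N, hMN, hNM⟩, mem_GLm.2 ?_⟩, ?_⟩
  · rw [← mem_GLm.1 g.2, ← hM]
    ext a b
    exact (plusFst_plusMap j _).symm
  · rw [GLMap_of]
    exact congrArg (GLof m C) (GLm_ext hM)

end

/-! ### Homomorphisms of groups modulo normal subgroups -/

/-- `f` induces a bijection `X / N → Y / M`. -/
def BijMod {X Y : Type*} [Group X] [Group Y] (N : Subgroup X) (M : Subgroup Y) (f : X →* Y) :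
    Prop :=
  (∀ x, f x ∈ M → x ∈ N) ∧ ∀ y, ∃ x, (f x)⁻¹ * y ∈ M

theorem BijMod.comp {X Y Z : Type*} [Group X] [Group Y] [Group Z] {N : Subgroup X} {M : Subgroup Y}
    {L : Subgroup Z} {f : X →* Y} {g : Y →* Z} (hg : BijMod M L g) (hf : BijMod N M f)
    (hM : ∀ y ∈ M, g y ∈ L) : BijMod N L (g.comp f) := by
  refine ⟨fun x hx => hf.1 _ (hg.1 _ hx), fun z => ?_⟩
  obtain ⟨y, hy⟩ := hg.2 z
  obtain ⟨x, hx⟩ := hf.2 y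
  refine ⟨x, ?_⟩
  have := mul_mem (hM _ hx) hy
  rw [map_mul, map_inv, mul_assoc, mul_inv_cancel_left] at this
  exact this

namespace AugGrp

/-- `j` identifies `X` with the cycles of `G` in degree `n`, and `N` with the boundaries. -/
structure IsCycles {X : Type*} [Group X] (N : Subgroup X) (G : AugGrp.{u}) (n : ℕ)
    (j : X →* G.X n) : Prop where
  injective : Function.Injective j
  range_eq : j.range = G.cycles n
  map_eq : N.map j = G.boundaries n

/-- Any model of the cycles and boundaries may replace the Moore complex. Here the models will be
the groups `GL` of iterated loop algebras. -/
theorem isIso_π_iff {G H : AugGrp.{u}} (a : G ⟶ H) (n : ℕ) {X Y : Type*} [Group X] [Group Y]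
    {N : Subgroup X} {M : Subgroup Y} {j : X →* G.X n} {i : Y →* H.X n} (hj : IsCycles N G n j)
    (hi : IsCycles M H n i) (f : X →* Y) (hf : ∀ x, (a.f n).hom (j x) = i (f x)) :
    IsIso ((π n).map a) ↔ BijMod N M f := by
  have hjN : ∀ x, j x ∈ G.boundaries n ↔ x ∈ N := fun x => by
    rw [← hj.map_eq, Subgroup.mem_map_iff_mem hj.injective]
  have hiM : ∀ y, i y ∈ H.boundaries n ↔ y ∈ M := fun y => by
    rw [← hi.map_eq, Subgroup.mem_map_iff_mem hi.injective]
  have hjc : ∀ x, j x ∈ G.cycles n := fun x => hj.range_eq ▸ ⟨x, rfl⟩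
  have hic : ∀ x, i x ∈ H.cycles n := fun x => hi.range_eq ▸ ⟨x, rfl⟩
  let p : X → (π n).obj G := fun x =>
    QuotientGroup.mk (s := (G.boundaries n).subgroupOf (G.cycles n)) ⟨j x, hjc x⟩
  let q : Y → (π n).obj H := fun x =>
    QuotientGroup.mk (s := (H.boundaries n).subgroupOf (H.cycles n)) ⟨i x, hic x⟩
  have hp : ∀ x x', p x = p x' ↔ x⁻¹ * x' ∈ N := fun x x' => by
    refine QuotientGroup.eq.trans (Subgroup.mem_subgroupOf.trans ?_)
    rw [← hjN, map_mul, map_inv]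
    rfl
  have hq : ∀ x x', q x = q x' ↔ x⁻¹ * x' ∈ M := fun x x' => by
    refine QuotientGroup.eq.trans (Subgroup.mem_subgroupOf.trans ?_)
    rw [← hiM, map_mul, map_inv]
    rfl
  have hps : Function.Surjective p := fun z => by
    obtain ⟨⟨z, hz⟩, rfl⟩ := QuotientGroup.mk_surjective z
    obtain ⟨x, rfl⟩ := hj.range_eq.symm ▸ hz
    exact ⟨x, rfl⟩
  have hqs : Function.Surjective q := fun z => by
    obtain ⟨⟨z, hz⟩, rfl⟩ := QuotientGroup.mk_surjective z
    obtain ⟨x, rfl⟩ := hi.range_eq.symm ▸ hz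
    exact ⟨x, rfl⟩
  have hpq : ∀ x, ((π n).map a).hom (p x) = q (f x) := fun x =>
    congrArg (QuotientGroup.mk (s := (H.boundaries n).subgroupOf (H.cycles n)))
      (Subtype.ext (hf x))
  have hp1 : ∀ x, p x = 1 ↔ x ∈ N := fun x => by
    refine (QuotientGroup.eq_one_iff _).trans (Subgroup.mem_subgroupOf.trans (hjN x))
  have hq1 : ∀ x, q x = 1 ↔ x ∈ M := fun x => by
    refine (QuotientGroup.eq_one_iff _).trans (Subgroup.mem_subgroupOf.trans (hiM x))
  rw [ConcreteCategory.isIso_iff_bijective]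
  refine and_congr ((injective_iff_map_eq_one ((π n).map a).hom).trans ⟨fun h x hx => ?_,
    fun h z hz => ?_⟩) ⟨fun h y => ?_, fun h z => ?_⟩
  · exact (hp1 x).1 (h (p x) ((hpq x).trans ((hq1 _).2 hx)))
  · obtain ⟨x, rfl⟩ := hps z
    exact (hp1 x).2 (h x ((hq1 _).1 ((hpq x).symm.trans hz)))
  · obtain ⟨z, hz⟩ := h (q y)
    obtain ⟨x, rfl⟩ := hps z
    exact ⟨x, (hq _ _).1 ((hpq x).symm.trans hz)⟩
  · obtain ⟨y, rfl⟩ := hqs z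
    obtain ⟨x, hx⟩ := h y
    exact ⟨p x, (hpq x).trans ((hq _ _).2 hx)⟩

end AugGrp

/-! ### Loops, and `K`-groups as groups of components -/

namespace PathFunctor

variable (P : PathFunctor.{u} k)

/-- The elements of `GL(B)` that are connected to `1` by a path. -/
def null (B : TopAlg.{u} k) : Subgroup (GLType B) := (GLMap (B := B) (P.τ.app B)).range

instance (B : TopAlg.{u} k) : (P.null B).Normal where
  conj_mem := by
    rintro _ ⟨y, rfl⟩ z
    obtain ⟨w, hw, -⟩ := P.exists_conj y z
    exact ⟨w, hw⟩

theorem map_mem_null {B C : TopAlg.{u} k} (φ : B ⟶ C) {x : GLType B} (hx : x ∈ P.null B) :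
    GLMap φ x ∈ P.null C := by
  obtain ⟨y, rfl⟩ := hx
  refine ⟨GLMap (P.ker.map φ) y, ?_⟩
  rw [← GLMap_comp, ← GLMap_comp]
  exact congrArg (fun ψ => GLMap ψ y) (P.τ.naturality φ)

/-- The loop algebra: the kernel of `τ`. -/
def loop : TopAlg.{u} k ⥤ TopAlg.{u} k where
  obj A := TopAlg.of k (kerSubalgebra (P.τ.app A))
  map φ := kerMap _ _ (P.ker.map φ) φ (P.τ.naturality φ)
  map_id A := TopAlg.hom_ext fun x => Subtype.ext
    (congrArg (fun ψ => TopAlg.Hom.toFun ψ x.1) (P.ker.map_id A))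
  map_comp φ ψ := TopAlg.hom_ext fun x => Subtype.ext
    (congrArg (fun χ => TopAlg.Hom.toFun χ x.1) (P.ker.map_comp φ ψ))

/-- The inclusion of the loops into the paths starting at `0`. -/
def loopIncl : P.loop ⟶ P.ker where
  app A := ⟨NonUnitalSubalgebraClass.subtype (kerSubalgebra (P.τ.app A)), continuous_subtype_val⟩

/-- The inclusion of the loops into all paths. -/
def loopPaths : P.loop ⟶ P.paths := P.loopIncl ≫ P.ι

/-- The two evaluations. -/
def ev (P : PathFunctor.{u} k) : Bool → (P.paths ⟶ 𝟭 (TopAlg.{u} k))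
  | false => P.ev₀
  | true => P.ev₁

theorem isKer_ι (A : TopAlg.{u} k) : IsKer (P.ι.app A) (fun _ : Unit => P.ev₀.app A) :=
  isKer_kerSubalgebra (P.ev₀.app A) _ fun _ => rfl

theorem isKer_loopIncl (A : TopAlg.{u} k) :
    IsKer (P.loopIncl.app A) (fun _ : Unit => P.τ.app A) :=
  isKer_kerSubalgebra (P.τ.app A) _ fun _ => rfl

/-- Presenting loops by two evaluations on all paths, both with values in the base algebra, is the
form that `CommutesWithMaps.of_isKer` requires. -/
theorem isKer_loopPaths (A : TopAlg.{u} k) :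
    IsKer (P.loopPaths.app A) (fun i => (P.ev i).app A) where
  emb := (P.isKer_ι A).emb.comp (P.isKer_loopIncl A).emb
  map_eq_zero b i := by
    cases i
    · exact (P.isKer_ι A).map_eq_zero ((P.loopIncl.app A).toFun b) ()
    · exact (P.isKer_loopIncl A).map_eq_zero b ()
  exists_eq c hc := by
    obtain ⟨b, rfl⟩ := (P.isKer_ι A).exists_eq c fun _ => hc false
    obtain ⟨a, rfl⟩ := (P.isKer_loopIncl A).exists_eq b fun _ => hc true
    exact ⟨a, rfl⟩

variable {P}

theorem preservesKer_ker (hP : PreservesKer P.paths) : PreservesKer P.ker :=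
  hP.of_isKer P.ι (fun _ : Unit => P.ev₀) P.isKer_ι

variable (P)

/-- The iterated loop algebras. -/
def loopIter : ℕ → (TopAlg.{u} k ⥤ TopAlg.{u} k)
  | 0 => 𝟭 _
  | n + 1 => loopIter n ⋙ P.loop

/-- The inclusion of the iterated loops into the iterated paths. -/
def loopIterIncl : ∀ n : ℕ, P.loopIter n ⟶ P.iter n
  | 0 => 𝟙 _
  | n + 1 => loopIterIncl n ◫ P.loopIncl

variable {P}

/-- The inductive step for iterated loops: `P.ker` preserves the kernel `j`, and the vanishing of
`τ` over `B` can be tested over `C`, by naturality of `τ` and injectivity of `j`. -/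
theorem isKer_loopIncl_comp_map (hP : PreservesKer P.ker) {ι ι' : Type} {B C : TopAlg.{u} k}
    {D : ι → TopAlg.{u} k} {D' : ι' → TopAlg.{u} k} {j : B ⟶ C} {d : ∀ i, C ⟶ D i}
    {d' : ∀ i, P.ker.obj C ⟶ D' i} (hj : IsKer j d)
    (hd : ∀ c, (∀ i, (d' i).toFun c = 0) ↔
      (P.τ.app C).toFun c = 0 ∧ ∀ i, (P.ker.map (d i)).toFun c = 0) :
    IsKer (P.loopIncl.app B ≫ P.ker.map j) d' where
  emb := (hP _ _ hj).emb.comp (P.isKer_loopIncl B).emb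
  map_eq_zero b := by
    refine (hd _).2 ⟨?_, fun i => (hP _ _ hj).map_eq_zero _ i⟩
    rw [TopAlg.comp_toFun, naturality_toFun]
    exact (congrArg j.toFun ((P.isKer_loopIncl B).map_eq_zero b ())).trans (map_zero j.toFun)
  exists_eq c hc := by
    obtain ⟨h0, h1⟩ := (hd c).1 hc
    obtain ⟨b, rfl⟩ := (hP _ _ hj).exists_eq c h1
    obtain ⟨a, rfl⟩ := (P.isKer_loopIncl B).exists_eq b fun _ => hj.injective <| by
      rw [map_zero, ← h0]
      exact (naturality_toFun P.τ j b).symm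
    exact ⟨a, rfl⟩

/-- The recursion of the faces matches that of the loops: the zeroth face is `τ`, the others are
`P.ker` applied to the faces one degree lower. -/
theorem isKer_loopIterIncl (hP : PreservesKer P.ker) (n : ℕ) (A : TopAlg.{u} k) :
    IsKer ((P.loopIterIncl (n + 1)).app A) (fun i => (P.face n i).app A) := by
  induction n with
  | zero =>
    -- The recursion starts from `A` as the kernel of the empty family on itself.
    refine isKer_loopIncl_comp_map hP (j := 𝟙 A) (ι := Empty) (D := fun _ => A)
      (d := fun i => i.elim) ⟨IsEmbedding.id, fun _ i => i.elim, fun c _ => ⟨c, rfl⟩⟩ fun c => ?_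
    exact ⟨fun h => ⟨h 0, fun i => i.elim⟩,
      fun h i => by rw [Subsingleton.elim (α := Fin 1) i 0]; exact h.1⟩
  | succ n ih =>
    refine isKer_loopIncl_comp_map hP ih fun c => ?_
    rw [Fin.forall_fin_succ]
    rfl

/-- A Moore chain one degree higher is killed by all faces except the zeroth. These are `P.ker` of
the faces below, so it comes from `GL(P(Ω^n A))`, and its zeroth face is the endpoint of that path.
-/
theorem isCycles_loopIterIncl (hP : PreservesKer P.ker) (n : ℕ) (A : TopAlg.{u} k) :
    AugGrp.IsCycles (P.null ((P.loopIter n).obj A)) (P.augGL.obj A) n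
      (GLMap ((P.loopIterIncl n).app A)) := by
  have hnat : ∀ n (y : GLType (P.ker.obj ((P.loopIter n).obj A))),
      GLMap ((P.loopIterIncl n).app A) (GLMap (P.τ.app ((P.loopIter n).obj A)) y) =
        GLMap ((P.face n 0).app A) (GLMap (P.ker.map ((P.loopIterIncl n).app A)) y) :=
    fun n y => by
      rw [face_zero]
      exact (GLMap_comp _ _ y).symm.trans ((congrArg (fun ψ => GLMap ψ y)
        (P.τ.naturality ((P.loopIterIncl n).app A)).symm).trans (GLMap_comp _ _ y))
  cases n with
  | zero =>
    have hid : ∀ x : GLType A, GLMap ((P.loopIterIncl 0).app A) x = x := GLMap_id A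
    refine ⟨fun x y h => (hid x).symm.trans (h.trans (hid y)), ?_, ?_⟩
    · refine (Subgroup.eq_top_iff' _).2 fun x => ⟨x, hid x⟩
    · ext x
      constructor
      · rintro ⟨_, ⟨y, rfl⟩, rfl⟩
        exact ⟨y, Subgroup.mem_iInf.2 fun i => i.elim0, (hid _).symm⟩
      · rintro ⟨y, -, rfl⟩
        exact ⟨_, ⟨y, rfl⟩, hid _⟩
  | succ n =>
    have hk := isKer_loopIterIncl hP n A
    refine ⟨hk.GLMap_injective, ?_, ?_⟩
    · ext x
      constructor
      · rintro ⟨x, rfl⟩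
        exact Subgroup.mem_iInf.2 fun i => hk.GLMap_eq_one x i
      · exact fun hx => hk.exists_GLMap_eq x fun i => Subgroup.mem_iInf.1 hx i
    · ext x
      constructor
      · rintro ⟨_, ⟨y, rfl⟩, rfl⟩
        exact ⟨GLMap (P.ker.map ((P.loopIterIncl (n + 1)).app A)) y,
          Subgroup.mem_iInf.2 fun i => (hP _ _ hk).GLMap_eq_one y i, (hnat (n + 1) y).symm⟩
      · rintro ⟨y, hy, rfl⟩
        obtain ⟨w, rfl⟩ := (hP _ _ hk).exists_GLMap_eq y fun i => Subgroup.mem_iInf.1 hy i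
        exact ⟨_, ⟨w, rfl⟩, hnat (n + 1) w⟩

/-- `K_{n+1}` detects isomorphisms on components of iterated loop algebras. -/
theorem isIso_KPath_map_iff (hP : PreservesKer P.ker) (n : ℕ) {A B : TopAlg.{u} k} (φ : A ⟶ B) :
    IsIso ((KPath k P (n + 1)).map φ) ↔
      BijMod (P.null ((P.loopIter n).obj A)) (P.null ((P.loopIter n).obj B))
        (GLMap ((P.loopIter n).map φ)) := by
  refine AugGrp.isIso_π_iff (P.augGL.map φ) n (isCycles_loopIterIncl hP n A)
    (isCycles_loopIterIncl hP n B) _ fun x => ?_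
  exact (GLMap_comp _ _ x).symm.trans ((congrArg (fun ψ => GLMap ψ x)
    ((P.loopIterIncl n).naturality φ).symm).trans (GLMap_comp _ _ x))

/-! ### Comparison of the loops of two path functors -/

variable {Q : PathFunctor.{u} k} (f : Hom k P Q)

/-- The morphism of loop algebras induced by a morphism of path functors. -/
def Hom.loop : P.loop ⟶ Q.loop where
  app A := kerMap _ _ (f.ker.app A) (𝟙 A) (f.ker_τ A)
  naturality _ _ φ := TopAlg.hom_ext fun x => Subtype.ext
    (congrArg (fun ψ => TopAlg.Hom.toFun ψ x.1) (f.ker.naturality φ))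

/-- The induced morphisms of iterated loop algebras. -/
def Hom.loopIter : ∀ n : ℕ, P.loopIter n ⟶ Q.loopIter n
  | 0 => 𝟙 _
  | n + 1 => Hom.loopIter n ◫ f.loop

theorem Hom.loopIter_comp_loopIterIncl (n : ℕ) (A : TopAlg.{u} k) :
    (f.loopIter n).app A ≫ (Q.loopIterIncl n).app A =
      (P.loopIterIncl n).app A ≫ (f.iter n).app A := by
  induction n with
  | zero => rfl
  | succ n ih =>
    refine TopAlg.hom_ext fun x => ?_
    have h1 : Q.ker.map ((f.loopIter n).app A) ≫ Q.ker.map ((Q.loopIterIncl n).app A) =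
        Q.ker.map ((P.loopIterIncl n).app A) ≫ Q.ker.map ((f.iter n).app A) := by
      rw [← Q.ker.map_comp, ih, Q.ker.map_comp]
    have h2 := naturality_toFun f.ker ((P.loopIterIncl n).app A)
      ((P.loopIncl.app ((P.loopIter n).obj A)).toFun x)
    exact (congrArg (fun ψ => TopAlg.Hom.toFun ψ ((f.ker.app ((P.loopIter n).obj A)).toFun
      ((P.loopIncl.app ((P.loopIter n).obj A)).toFun x))) h1).trans
      (congrArg (Q.ker.map ((f.iter n).app A)).toFun h2.symm)

/-- For the morphism from smooth to continuous paths the left side is the assertion about `β`. The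
right side mixes two notions of component, smooth in the source and continuous in the target. -/
theorem isIso_whiskerRight_π_iff (hP : PreservesKer P.ker) (hQ : PreservesKer Q.ker) (n : ℕ)
    (A : TopAlg.{u} k) :
    IsIso ((AugGrp.π n).map (f.augGL.app A)) ↔
      BijMod (P.null ((P.loopIter n).obj A)) (Q.null ((Q.loopIter n).obj A))
        (GLMap ((f.loopIter n).app A)) := by
  refine AugGrp.isIso_π_iff (f.augGL.app A) n (isCycles_loopIterIncl hP n A)
    (isCycles_loopIterIncl hQ n A) _ fun x => ?_
  exact (GLMap_comp _ _ x).symm.trans ((congrArg (fun ψ => GLMap ψ x)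
    (f.loopIter_comp_loopIterIncl n A).symm).trans (GLMap_comp _ _ x))

end PathFunctor

/-! ### Local convexity and the mean value inequality -/

/-- The topology is defined by continuous seminorms. -/
def LocConvex (A : TopAlg.{u} k) : Prop :=
  ∀ U ∈ 𝓝 (0 : A), ∃ p : Seminorm k A, Continuous p ∧ ∀ a, p a < 1 → a ∈ U

theorem locConvex_of_polynormable (A : Type u) [NonUnitalRing A] [Module k A]
    [IsScalarTower k A A] [SMulCommClass k A A] [TopologicalSpace A]
    [IsTopologicalRing A] [ContinuousSMul k A] [T2Space A] [PolynormableSpace k A] :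
    LocConvex (TopAlg.of k A) := by
  intro U hU
  obtain ⟨⟨s, r⟩, hr, hs⟩ := (PolynormableSpace.withSeminorms k A).hasBasis_zero_ball.mem_iff.1 hU
  let q : Seminorm k A := s.sup fun p : {p : Seminorm k A // Continuous p} => p.1
  have hc : Continuous q := by
    refine Seminorm.continuous (r := 1) ?_
    exact (PolynormableSpace.withSeminorms k A).hasBasis_zero_ball.mem_of_mem (i := (s, 1)) one_pos
  have hr' : (0 : ℝ) < r := hr
  -- Rescaling turns the ball of radius `r` into the unit ball.
  let c : NNReal := ⟨r⁻¹, by positivity⟩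
  refine ⟨c • q, ?_, fun a ha => hs ?_⟩
  · exact (continuous_const (y := r⁻¹)).mul hc
  · have h1 : r⁻¹ * q a < 1 := ha
    rw [inv_mul_lt_one₀ hr'] at h1
    exact (Seminorm.mem_ball_zero _).2 h1

/-- A neighbourhood of `0` constrains only finitely many indices, and the sum of the pulled back
seminorms dominates each of them. This covers kernels (one map) and smooth paths (all derivatives).
-/
theorem LocConvex.of_isInducing {ι : Type*} {A : TopAlg.{u} k} {B : ι → TopAlg.{u} k}
    (hB : ∀ i, LocConvex (B i)) (ℓ : ∀ i, A →ₗ[k] B i)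
    (hℓ : IsInducing fun (a : A) i => ℓ i a) : LocConvex A := by
  intro U hU
  have hc : ∀ i, Continuous (ℓ i) := fun i => (continuous_apply i).comp hℓ.continuous
  rw [hℓ.nhds_eq_comap] at hU
  obtain ⟨V, hV, hVU⟩ := hU
  have h0 : (fun i => ℓ i (0 : A)) = 0 := funext fun i => map_zero _
  rw [h0, nhds_pi, Filter.mem_pi] at hV
  obtain ⟨s, hs, t, ht, hst⟩ := hV
  choose p hp hpt using fun i => hB i (t i) (ht i)
  have hsum : ⇑(∑ i ∈ hs.toFinset, (p i).comp (ℓ i)) = fun a => ∑ i ∈ hs.toFinset, p i (ℓ i a) := by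
    funext a
    simp
  refine ⟨∑ i ∈ hs.toFinset, (p i).comp (ℓ i), ?_, fun a ha => hVU (hst fun i hi => hpt i _ ?_)⟩
  · rw [hsum]
    exact continuous_finsetSum _ fun i _ => (hp i).comp (hc i)
  · refine lt_of_le_of_lt ?_ ha
    rw [hsum]
    exact Finset.single_le_sum (f := fun i => p i (ℓ i a)) (fun i _ => apply_nonneg _ _)
      (hs.mem_toFinset.2 hi)

theorem IsKer.locConvex {ι : Type} {B C : TopAlg.{u} k} {D : ι → TopAlg.{u} k} {j : B ⟶ C}
    {d : ∀ i, C ⟶ D i} (h : IsKer j d) (hC : LocConvex C) : LocConvex B := by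
  refine LocConvex.of_isInducing (ι := Unit) (fun _ => hC) (fun _ => (j.toFun : B →ₗ[k] C)) ?_
  refine IsInducing.of_comp (continuous_pi fun _ => j.cont) (continuous_apply ()) ?_
  exact h.emb.isInducing

theorem LocConvex.contMaps {A : TopAlg.{u} k} (hA : LocConvex A) (X : Type) [TopologicalSpace X]
    [LocallyCompactSpace X] [CompactSpace X] : LocConvex ((contMaps k X).obj A) := by
  intro U hU
  have hb := (Filter.basis_sets (𝓝 (0 : A))).nhds_continuousMapConst (X := X)
  obtain ⟨⟨K, V⟩, ⟨-, hV⟩, hVU⟩ := hb.mem_iff.1 hU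
  obtain ⟨p, hp, hpV⟩ := hA V hV
  let q : C(X, A) → C(X, ℝ) := fun f => (⟨p, hp⟩ : C(A, ℝ)).comp f
  -- The supremum of `p ∘ f` over the compact space `X`, taken as a norm in `C(X, ℝ)`.
  let P : Seminorm k C(X, A) := Seminorm.of (fun f => ‖q f‖)
    (fun f g => (ContinuousMap.norm_le _ (by positivity)).2 fun x => by
      have h1 := (q f).norm_coe_le_norm x
      have h2 := (q g).norm_coe_le_norm x
      have h3 : ‖q (f + g) x‖ ≤ ‖q f x‖ + ‖q g x‖ := by
        simp only [q, ContinuousMap.comp_apply, ContinuousMap.coe_mk, ContinuousMap.add_apply,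
          Real.norm_of_nonneg (apply_nonneg p _)]
        exact map_add_le_add p _ _
      linarith)
    (fun c f => by
      have : q (c • f) = ‖c‖ • q f := ContinuousMap.ext fun x => map_smul_eq_mul p c (f x)
      rw [this, norm_smul, norm_norm])
  refine ⟨P, ?_, fun f hf => hVU ?_⟩
  · exact (continuous_norm (E := C(X, ℝ))).comp
      (ContinuousMap.continuous_postcomp (X := X) (⟨p, hp⟩ : C(A, ℝ)))
  · intro x _
    refine hpV _ (lt_of_le_of_lt ?_ hf)
    exact (le_abs_self _).trans ((q f).norm_coe_le_norm x)

theorem LocConvex.smoothMaps {A : TopAlg.{u} k} (hA : LocConvex A) :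
    LocConvex ((smoothMaps k).obj A) :=
  LocConvex.of_isInducing (A := (SmoothK.smoothMaps k).obj A)
    (B := fun _ : ℕ => (SmoothK.contMaps k I).obj A)
    (fun _ => hA.contMaps I) (fun n => LinearMap.proj n ∘ₗ SmoothPath.jet A) ⟨rfl⟩

/-- The mean value inequality for a continuous seminorm. -/
theorem seminorm_sub_le_of_hasPathDeriv {A : TopAlg.{u} k} (p : Seminorm k A) (hp : Continuous p)
    {f : I → A} (hf : Continuous f) {f' : I → A} (hd : ∀ t, HasPathDeriv k f (f' t) t) {C : ℝ}
    {a b : I} (hab : a ≤ b) (hC : ∀ t, a ≤ t → t ≤ b → p (f' t) ≤ C) :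
    p (f b - f a) ≤ C * ((b : ℝ) - a) := by
  -- The projection extends the path to the real line. By the triangle inequality the right slopes
  -- of `F` are at most `p` of the difference quotients of `f`, so a comparison of real functions
  -- suffices.
  let F : ℝ → ℝ := fun x => p (f (Set.projIcc 0 1 zero_le_one x) - f a)
  have hF : Continuous F := hp.comp ((hf.comp continuous_projIcc).sub continuous_const)
  have hval : ∀ t : I, F t = p (f t - f a) := fun t => by
    simp only [F, Set.projIcc_val]
  have key := image_le_of_liminf_slope_right_le_deriv_boundary (f := F) (a := a) (b := b)
    (B := fun x => C * (x - a)) (B' := fun _ => C) hF.continuousOn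
    (by rw [hval]; simp) (by fun_prop)
    (fun x _ => by
      simpa using (((hasDerivAt_id x).sub_const (a : ℝ)).const_mul C).hasDerivWithinAt)
    (fun x hx r hr => ?_) (Set.right_mem_Icc.2 hab)
  · rwa [hval] at key
  obtain ⟨hax, hxb⟩ := hx
  have hx1 : x < 1 := hxb.trans_le b.2.2
  let t : I := ⟨x, a.2.1.trans hax, hx1.le⟩
  have ht : Filter.Tendsto (fun s : I => p ((((s : ℝ) - (t : ℝ) : ℝ) : k)⁻¹ • (f s - f t)))
      (𝓝[≠] t) (𝓝 (p (f' t))) := (hp.tendsto _).comp (hd t)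
  have hlt : p (f' t) < r := (hC t hax hxb.le).trans_lt hr
  have hproj : Filter.Tendsto (Set.projIcc (0 : ℝ) 1 zero_le_one) (𝓝[>] x) (𝓝[≠] t) := by
    refine tendsto_nhdsWithin_iff.2 ⟨?_, ?_⟩
    · have : Set.projIcc (0 : ℝ) 1 zero_le_one x = t := Set.projIcc_of_mem zero_le_one t.2
      rw [← this]
      exact (continuous_projIcc.tendsto x).mono_left nhdsWithin_le_nhds
    · filter_upwards [Ioo_mem_nhdsGT hx1] with z hz hzt
      have := congrArg Subtype.val hzt
      rw [Set.projIcc_of_mem zero_le_one ⟨t.2.1.trans hz.1.le, hz.2.le⟩] at this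
      exact hz.1.ne' this
  refine Filter.Eventually.frequently ?_
  filter_upwards [hproj.eventually (ht.eventually (gt_mem_nhds hlt)), Ioo_mem_nhdsGT hx1]
    with z hz hz1
  refine lt_of_le_of_lt ?_ hz
  have hzI : z ∈ I := ⟨t.2.1.trans hz1.1.le, hz1.2.le⟩
  have hFx : F x = p (f t - f a) := hval t
  have hFz : F z = p (f ⟨z, hzI⟩ - f a) := hval ⟨z, hzI⟩
  have hpos : 0 < z - x := sub_pos.2 hz1.1
  rw [Set.projIcc_of_mem zero_le_one hzI, map_smul_eq_mul, norm_inv, RCLike.norm_ofReal,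
    slope_def_field, hFx, hFz]
  change _ ≤ |z - x|⁻¹ * _
  rw [abs_of_pos hpos, div_eq_inv_mul]
  refine mul_le_mul_of_nonneg_left ?_ (by positivity)
  have := map_add_le_add p (f ⟨z, hzI⟩ - f t) (f t - f a)
  rw [sub_add_sub_cancel] at this
  linarith

theorem HasPathDeriv.linear {A : TopAlg.{u} k} (a : A) (t : I) :
    HasPathDeriv k (fun s : I => (((s : ℝ) : ℝ) : k) • a) a t := by
  refine tendsto_const_nhds.congr' ?_
  filter_upwards [self_mem_nhdsWithin] with s hs
  have : (((s : ℝ) - (t : ℝ) : ℝ) : k) ≠ 0 :=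
    RCLike.ofReal_ne_zero.2 (sub_ne_zero.2 fun h => hs (Subtype.ext h))
  rw [← sub_smul, ← RCLike.ofReal_sub, smul_smul, inv_mul_cancel₀ this, one_smul]

/-- A family of paths, jointly continuous together with its derivatives, is differentiable as a path
of maps. -/
theorem hasPathDeriv_of_forall {A : TopAlg.{u} k} (hA : LocConvex A) {X : Type}
    [TopologicalSpace X] [LocallyCompactSpace X] (f f' : C(I, C(X, A)))
    (h : ∀ t x, HasPathDeriv k (fun s => f s x) (f' t x) t) (t : I) :
    HasPathDeriv k f (f' t) t := by
  rw [HasPathDeriv, ← tendsto_sub_nhds_zero_iff]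
  have hb := (Filter.basis_sets (𝓝 (0 : A))).nhds_continuousMapConst (X := X)
  refine hb.tendsto_right_iff.2 ?_
  rintro ⟨K, U⟩ ⟨hK, hU⟩
  obtain ⟨p, hp, hpU⟩ := hA U hU
  have hO : IsOpen {a : A | p a < 1 / 2} := isOpen_lt hp continuous_const
  -- Continuity of `f'` into the compact-open topology makes this closeness uniform over `K`.
  have hnear : ∀ᶠ s in 𝓝 t, ∀ x ∈ K, p (f' s x - f' t x) < 1 / 2 := by
    have hc : Continuous fun s => f' s - f' t := f'.continuous.sub continuous_const
    have := (hc.tendsto t).eventually (ContinuousMap.eventually_mapsTo hK hO (fun x _ => by simp))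
    exact this
  obtain ⟨ε, hε, hball⟩ := Metric.eventually_nhds_iff_ball.1 hnear
  filter_upwards [nhdsWithin_le_nhds (Metric.ball_mem_nhds t hε), self_mem_nhdsWithin]
    with s hs hst x hx
  refine hpU _ ?_
  -- Removing the linear path with velocity `f' t x` leaves a path whose derivative `f' u x - f' t
  -- x` is small near `t`; the mean value inequality then bounds the error of the difference
  -- quotient uniformly in `x`.
  let g : I → A := fun u => f u x - (((u : ℝ) : ℝ) : k) • f' t x
  have hev : Continuous fun u => f u x := (continuous_eval_const x).comp f.continuous
  have hg : Continuous g := by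
    refine hev.sub (Continuous.smul ?_ continuous_const)
    exact RCLike.continuous_ofReal.comp continuous_subtype_val
  have hg' : ∀ u, HasPathDeriv k g (f' u x - f' t x) u := fun u => by
    have := (h u x).add ((HasPathDeriv.linear (f' t x) u).smul (-1 : k))
    rw [neg_smul, neg_smul, one_smul, one_smul, ← sub_eq_add_neg, ← sub_eq_add_neg] at this
    exact this
  have hbound : p (g s - g t) ≤ 1 / 2 * |(s : ℝ) - t| := by
    have hseg : ∀ u : I, (dist u t ≤ dist s t) → p (f' u x - f' t x) ≤ 1 / 2 := fun u hu =>
      (hball u (lt_of_le_of_lt hu hs) x hx).le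
    rcases le_total s t with hle | hle
    · have := seminorm_sub_le_of_hasPathDeriv p hp hg hg' hle fun u h1 h2 => hseg u (by
        rw [Subtype.dist_eq, Subtype.dist_eq, Real.dist_eq, Real.dist_eq]
        have h1' : (s : ℝ) ≤ u := h1
        have h2' : (u : ℝ) ≤ t := h2
        rw [abs_of_nonpos (by linarith), abs_of_nonpos (by linarith)]
        linarith)
      rw [map_sub_rev] at this
      rwa [abs_sub_comm, abs_of_nonneg (sub_nonneg.2 (show (s : ℝ) ≤ t from hle))]
    · have := seminorm_sub_le_of_hasPathDeriv p hp hg hg' hle fun u h1 h2 => hseg u (by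
        rw [Subtype.dist_eq, Subtype.dist_eq, Real.dist_eq, Real.dist_eq]
        have h1' : (t : ℝ) ≤ u := h1
        have h2' : (u : ℝ) ≤ s := h2
        rw [abs_of_nonneg (by linarith), abs_of_nonneg (by linarith)]
        linarith)
      rwa [abs_of_nonneg (sub_nonneg.2 (show (t : ℝ) ≤ s from hle))]
  have hne : (s : ℝ) - t ≠ 0 := sub_ne_zero.2 fun h => hst (Subtype.ext h)
  have hne' : (((s : ℝ) - (t : ℝ) : ℝ) : k) ≠ 0 := RCLike.ofReal_ne_zero.2 hne
  have heq : (((((s : ℝ) - (t : ℝ) : ℝ) : k)⁻¹ • (f s - f t) - f' t : C(X, A)) x) =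
      (((s : ℝ) - (t : ℝ) : ℝ) : k)⁻¹ • (g s - g t) := by
    have : g s - g t = (f s x - f t x) - (((s : ℝ) - (t : ℝ) : ℝ) : k) • f' t x := by
      simp only [g, RCLike.ofReal_sub, sub_smul]
      abel
    rw [this, smul_sub _ (f s x - f t x), smul_smul, inv_mul_cancel₀ hne', one_smul]
    rfl
  rw [heq, map_smul_eq_mul, norm_inv, RCLike.norm_ofReal]
  have h2 : 0 < |(s : ℝ) - t| := abs_pos.2 hne
  calc |(s : ℝ) - t|⁻¹ * p (g s - g t) ≤ |(s : ℝ) - t|⁻¹ * (1 / 2 * |(s : ℝ) - t|) := by gcongr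
    _ = 1 / 2 := by field_simp
    _ < 1 := by norm_num

/-! ### Exchange of mapping spaces with other functors -/

/-- A set-theoretic section of an injective homomorphism is automatically a homomorphism; only its
continuity must be supplied. -/
theorem TopAlg.exists_section {B C : TopAlg.{u} k} (φ : B ⟶ C) (hφ : Function.Injective φ.toFun)
    (η : C → B) (hη : ∀ c, φ.toFun (η c) = c) (hc : Continuous η) : ∃ ψ : C ⟶ B, ψ ≫ φ = 𝟙 C :=
  ⟨{ toFun :=
      { toFun := η
        map_smul' := fun c x => hφ (by rw [hη, MonoidHom.id_apply, map_smul, hη])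
        map_zero' := hφ (by rw [hη, map_zero])
        map_add' := fun x y => hφ (by rw [hη, map_add, hη, hη])
        map_mul' := fun x y => hφ (by rw [hη, map_mul, hη, hη]) }
     cont := hc }, TopAlg.hom_ext hη⟩

/-- Evaluation at a point. -/
abbrev evalAt {X : Type} [TopologicalSpace X] [LocallyCompactSpace X] (x : X) (A : TopAlg.{u} k) :
    (contMaps k X).obj A ⟶ A := (evalMaps k X x).app A

/-- Inclusion of the constant maps. -/
abbrev constAt (X : Type) [TopologicalSpace X] [LocallyCompactSpace X] (A : TopAlg.{u} k) :
    A ⟶ (contMaps k X).obj A := (constMaps k X).app A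

theorem contMaps_ext {X : Type} [TopologicalSpace X] [LocallyCompactSpace X] {A : TopAlg.{u} k}
    {f g : (contMaps k X).obj A} (h : ∀ x, (evalAt x A).toFun f = (evalAt x A).toFun g) : f = g :=
  ContinuousMap.ext (X := X) (Y := A) h

theorem contMaps_hom_ext {X : Type} [TopologicalSpace X] [LocallyCompactSpace X]
    {A E : TopAlg.{u} k} {f g : E ⟶ (contMaps k X).obj A}
    (h : ∀ x, f ≫ evalAt x A = g ≫ evalAt x A) : f = g :=
  TopAlg.hom_ext fun a => contMaps_ext fun x => congrArg (fun φ => TopAlg.Hom.toFun φ a) (h x)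

theorem map_evalAt {X : Type} [TopologicalSpace X] [LocallyCompactSpace X] {A B : TopAlg.{u} k}
    (φ : A ⟶ B) (x : X) : (contMaps k X).map φ ≫ evalAt x B = evalAt x A ≫ φ := rfl

theorem constAt_evalAt {X : Type} [TopologicalSpace X] [LocallyCompactSpace X] {A : TopAlg.{u} k}
    (x : X) : constAt X A ≫ evalAt x A = 𝟙 A := rfl

/-- `F` preserves kernels and local convexity, and commutes with the formation of algebras of
continuous maps on compact spaces. -/
structure CommutesWithMaps (F : TopAlg.{u} k ⥤ TopAlg.{u} k) : Prop where
  preservesKer : PreservesKer F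
  locConvex : ∀ {A}, LocConvex A → LocConvex (F.obj A)
  exchange : ∀ {A}, LocConvex A → ∀ (X : Type) [TopologicalSpace X] [LocallyCompactSpace X]
    [CompactSpace X], ∃ θ : F.obj ((contMaps k X).obj A) ≅ (contMaps k X).obj (F.obj A),
      ∀ x, θ.hom ≫ evalAt x (F.obj A) = F.map (evalAt x A)

namespace CommutesWithMaps

theorem id : CommutesWithMaps (𝟭 (TopAlg.{u} k)) :=
  ⟨PreservesKer.id, fun h => h, fun _ _ _ _ _ => ⟨Iso.refl _, fun _ => rfl⟩⟩

theorem comp {F G : TopAlg.{u} k ⥤ TopAlg.{u} k} (hF : CommutesWithMaps F)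
    (hG : CommutesWithMaps G) : CommutesWithMaps (F ⋙ G) where
  preservesKer := PreservesKer.comp hF.preservesKer hG.preservesKer
  locConvex hA := hG.locConvex (hF.locConvex hA)
  exchange {A} hA X _ _ _ := by
    obtain ⟨θ, hθ⟩ := hF.exchange hA X
    obtain ⟨η, hη⟩ := hG.exchange (hF.locConvex hA) X
    refine ⟨G.mapIso θ ≪≫ η, fun x => ?_⟩
    rw [Iso.trans_hom, Category.assoc]
    refine (congrArg (_ ≫ ·) (hη x)).trans ?_
    rw [Functor.mapIso_hom, ← G.map_comp, hθ, Functor.comp_map]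

/-- Under `F(A^X) ≅ F(A)^X` the map `e i` becomes the pointwise `e i`, as naturality shows at every
evaluation. The isomorphism therefore restricts to the kernels. -/
theorem of_isKer {F F' : TopAlg.{u} k ⥤ TopAlg.{u} k} (hF : CommutesWithMaps F) {κ : Type}
    (α : F' ⟶ F) (e : κ → (F ⟶ 𝟭 _)) (h : ∀ A, IsKer (α.app A) (fun i => (e i).app A)) :
    CommutesWithMaps F' where
  preservesKer := PreservesKer.of_isKer hF.preservesKer α e h
  locConvex hA := (h _).locConvex (hF.locConvex hA)
  exchange {A} hA X _ _ _ := by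
    obtain ⟨θ, hθ⟩ := hF.exchange hA X
    have h' := preservesKer_contMaps X _ _ (h A)
    have hev : ∀ i x, θ.hom ≫ (contMaps k X).map ((e i).app A) ≫ evalAt x A =
        (e i).app ((contMaps k X).obj A) ≫ evalAt x A := fun i x => by
      refine Eq.trans ?_ ((e i).naturality (evalAt x A))
      rw [← hθ x, Category.assoc]
      rfl
    have hev' : ∀ i, θ.hom ≫ (contMaps k X).map ((e i).app A) =
        (e i).app ((contMaps k X).obj A) := fun i =>
      contMaps_hom_ext fun x => (Category.assoc _ _ _).trans (hev i x)
    obtain ⟨θ', hθ'⟩ := (h ((contMaps k X).obj A)).exists_iso h' θ fun c => forall_congr' fun i => by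
      rw [← hev' i]
      rfl
    refine ⟨θ', fun x => (h A).hom_ext ?_⟩
    calc (θ'.hom ≫ evalAt x _) ≫ α.app A
        = (θ'.hom ≫ (contMaps k X).map (α.app A)) ≫ evalAt x _ := rfl
      _ = α.app _ ≫ F.map (evalAt x A) := by rw [hθ', Category.assoc, hθ]
      _ = F'.map (evalAt x A) ≫ α.app A := (α.naturality _).symm

end CommutesWithMaps

/-! ### Exchange of variables and currying -/

section Swap

variable {X Y : Type} [TopologicalSpace X] [LocallyCompactSpace X] [TopologicalSpace Y]
  [LocallyCompactSpace Y]

/-- Exchange of the variables of a map of two variables. -/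
def swapMap {A : Type*} [TopologicalSpace A] (f : C(Y, C(X, A))) : C(X, C(Y, A)) :=
  (f.uncurry.comp ⟨Prod.swap, continuous_swap⟩).curry

theorem continuous_swapMap {A : Type*} [TopologicalSpace A] :
    Continuous (swapMap : C(Y, C(X, A)) → C(X, C(Y, A))) :=
  ContinuousMap.continuous_curry.comp
    ((ContinuousMap.continuous_precomp _).comp ContinuousMap.continuous_uncurry)

/-- `(A^X)^Y ≅ (A^Y)^X`. -/
def swapIso (A : TopAlg.{u} k) :
    (contMaps k Y).obj ((contMaps k X).obj A) ≅ (contMaps k X).obj ((contMaps k Y).obj A) where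
  hom :=
    { toFun :=
        { toFun := fun f => swapMap (X := X) (Y := Y) (A := A) f
          map_smul' := fun _ _ => rfl
          map_zero' := rfl
          map_add' := fun _ _ => rfl
          map_mul' := fun _ _ => rfl }
      cont := continuous_swapMap }
  inv :=
    { toFun :=
        { toFun := fun f => swapMap (X := Y) (Y := X) (A := A) f
          map_smul' := fun _ _ => rfl
          map_zero' := rfl
          map_add' := fun _ _ => rfl
          map_mul' := fun _ _ => rfl }
      cont := continuous_swapMap }
  hom_inv_id := rfl
  inv_hom_id := rfl

/-- `A^{X × Y} ≅ (A^X)^Y`. -/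
def curryIso (X Y : Type) [TopologicalSpace X] [LocallyCompactSpace X] [TopologicalSpace Y]
    [LocallyCompactSpace Y] (A : TopAlg.{u} k) :
    (contMaps k (Y × X)).obj A ≅ (contMaps k Y).obj ((contMaps k X).obj A) where
  hom :=
    { toFun :=
        { toFun := fun f => ContinuousMap.curry (X := Y) (Y := X) (Z := A) f
          map_smul' := fun _ _ => rfl
          map_zero' := rfl
          map_add' := fun _ _ => rfl
          map_mul' := fun _ _ => rfl }
      cont := ContinuousMap.continuous_curry }
  inv :=
    { toFun :=
        { toFun := fun f => ContinuousMap.uncurry (X := Y) (Y := X) (Z := A) f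
          map_smul' := fun _ _ => rfl
          map_zero' := rfl
          map_add' := fun _ _ => rfl
          map_mul' := fun _ _ => rfl }
      cont := ContinuousMap.continuous_uncurry }
  hom_inv_id := rfl
  inv_hom_id := rfl

end Swap

theorem commutesWithMaps_contMaps (Y : Type) [TopologicalSpace Y] [LocallyCompactSpace Y]
    [CompactSpace Y] : CommutesWithMaps (contMaps.{u} k Y) where
  preservesKer := preservesKer_contMaps Y
  locConvex hA := hA.contMaps Y
  exchange {A} _ _ _ _ _ := ⟨swapIso A, fun _ => rfl⟩

/-! ### Smooth paths of maps as maps to smooth paths -/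

section Smooth

variable {X : Type} [TopologicalSpace X] [LocallyCompactSpace X] (A : TopAlg.{u} k)

theorem jet_mapFun_evalAt (x : X) (f : SmoothPath ((contMaps k X).obj A)) (n : ℕ) :
    SmoothPath.jet A (SmoothPath.mapFun k (evalAt x A) f) n =
      swapMap (X := X) (A := A) (SmoothPath.jet _ f n) x :=
  SmoothPath.jet_mapFun k (evalAt x A) n f

/-- Joint continuity in the path and the point gives, by currying, both the continuity of each
exchanged map and that of `smoothExchange`. -/
theorem continuous_mapFun_evalAt :
    Continuous fun p : SmoothPath ((contMaps k X).obj A) × X =>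
      SmoothPath.mapFun k (evalAt p.2 A) p.1 := by
  refine SmoothPath.continuous_iff.2 fun n => ?_
  simp only [jet_mapFun_evalAt]
  have h : Continuous fun f : SmoothPath ((contMaps k X).obj A) =>
      swapMap (X := X) (A := A) (SmoothPath.jet _ f n) :=
    continuous_swapMap.comp (SmoothPath.continuous_jet n)
  exact (h.comp continuous_fst).eval continuous_snd

/-- A smooth path of maps, as a map to smooth paths. -/
def smoothExchange :
    (smoothMaps k).obj ((contMaps k X).obj A) ⟶ (contMaps k X).obj ((smoothMaps k).obj A) where
  toFun :=
    { toFun := fun f => (⟨fun x => SmoothPath.mapFun k (evalAt x A) f,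
        (continuous_mapFun_evalAt A).comp (Continuous.prodMk_right f)⟩ : C(X, SmoothPath A))
      map_smul' := fun c f => ContinuousMap.ext fun x =>
        map_smul (SmoothPath.mapFun k (evalAt x A)) c f
      map_zero' := ContinuousMap.ext fun x => map_zero (SmoothPath.mapFun k (evalAt x A))
      map_add' := fun f g => ContinuousMap.ext fun x =>
        map_add (SmoothPath.mapFun k (evalAt x A)) f g
      map_mul' := fun f g => ContinuousMap.ext fun x =>
        map_mul (SmoothPath.mapFun k (evalAt x A)) f g }
  cont := ContinuousMap.continuous_of_continuous_uncurry _ (continuous_mapFun_evalAt A)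

variable {A}

/-- The derivatives of a family of smooth paths. -/
def familyJet (g : C(X, SmoothPath A)) (n : ℕ) : C(I, C(X, A)) :=
  swapMap (X := I) (Y := X) ((⟨_, SmoothPath.continuous_jet n⟩ : C(SmoothPath A, C(I, A))).comp g)

theorem continuous_familyJet (n : ℕ) :
    Continuous fun g : C(X, SmoothPath A) => familyJet g n :=
  continuous_swapMap.comp (ContinuousMap.continuous_postcomp _)

/-- Local convexity enters here: derivatives taken separately at each point of `X` are derivatives
in the algebra of maps. -/
theorem exists_jet_eq_familyJet (hA : LocConvex A) (g : C(X, SmoothPath A)) :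
    ∃ f : SmoothPath ((contMaps k X).obj A), SmoothPath.jet _ f = familyJet g :=
  SmoothPath.exists_jet_eq (A := (contMaps k X).obj A) (familyJet g)
    fun n t => hasPathDeriv_of_forall hA (familyJet g n) (familyJet g (n + 1))
      (fun t x => SmoothPath.jet_hasPathDeriv (g x) n t) t

theorem smoothExchange_injective :
    Function.Injective (smoothExchange (X := X) A).toFun := by
  intro f g h
  refine SmoothPath.incl_injective (ContinuousMap.ext fun t => contMaps_ext fun x => ?_)
  exact congrArg (fun φ : C(X, SmoothPath A) => SmoothPath.incl A (φ x) t) h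

theorem exists_smoothExchange_inv (hA : LocConvex A) :
    ∃ η : (contMaps k X).obj ((smoothMaps k).obj A) ⟶ (smoothMaps k).obj ((contMaps k X).obj A),
      η ≫ smoothExchange A = 𝟙 _ := by
  choose η hη using exists_jet_eq_familyJet (X := X) hA
  refine TopAlg.exists_section _ smoothExchange_injective η (fun g => ?_)
    (SmoothPath.continuous_iff.2 fun n => ?_)
  · exact ContinuousMap.ext fun x => SmoothPath.jet_injective <| funext fun n => by
      exact (jet_mapFun_evalAt A x (η g) n).trans
        (congrArg (fun F : ℕ → C(I, C(X, A)) => swapMap (X := X) (Y := I) (F n) x) (hη g))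
  · exact (continuous_familyJet n).congr fun g => (congrFun (hη g) n).symm

end Smooth

theorem commutesWithMaps_smoothMaps : CommutesWithMaps (smoothMaps.{u} k) where
  preservesKer := preservesKer_smoothMaps
  locConvex hA := hA.smoothMaps
  exchange {A} hA X _ _ _ := by
    obtain ⟨η, hη⟩ := exists_smoothExchange_inv (X := X) hA
    refine ⟨⟨smoothExchange A, η, TopAlg.hom_ext fun f => smoothExchange_injective ?_, hη⟩,
      fun _ => rfl⟩
    exact congrArg (fun φ => TopAlg.Hom.toFun φ ((smoothExchange A).toFun f)) hη

theorem PathFunctor.commutesWithMaps_loop {P : PathFunctor.{u} k} (hP : CommutesWithMaps P.paths) :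
    CommutesWithMaps P.loop :=
  hP.of_isKer P.loopPaths P.ev P.isKer_loopPaths

theorem PathFunctor.commutesWithMaps_loopIter {P : PathFunctor.{u} k}
    (hP : CommutesWithMaps P.paths) (n : ℕ) : CommutesWithMaps (P.loopIter n) := by
  induction n with
  | zero => exact CommutesWithMaps.id
  | succ n ih => exact ih.comp (commutesWithMaps_loop hP)

/-! ### The contraction of smooth paths -/

theorem HasPathDeriv.comp_mul {A : TopAlg.{u} k} {f : I → A} {a : A} {s t : I}
    (h : HasPathDeriv k f a (s * t)) :
    HasPathDeriv k (fun r => f (r * t)) ((((t : ℝ) : ℝ) : k) • a) s := by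
  -- For `t = 0` the map `r ↦ r * t` is constant and does not respect punctured neighbourhoods, so
  -- the limit cannot be composed.
  by_cases ht : t = 0
  · subst ht
    have := HasPathDeriv.const (k := k) (f 0) s
    simpa using this
  have ht' : (t : ℝ) ≠ 0 := fun h => ht (Subtype.ext h)
  have htk : (((t : ℝ) : ℝ) : k) ≠ 0 := RCLike.ofReal_ne_zero.2 ht'
  have hm : Filter.Tendsto (fun r : I => r * t) (𝓝[≠] s) (𝓝[≠] (s * t)) := by
    refine tendsto_nhdsWithin_iff.2 ⟨?_, ?_⟩
    · exact ((continuous_mul_const t).tendsto s).mono_left nhdsWithin_le_nhds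
    · filter_upwards [self_mem_nhdsWithin] with r hr hrt
      exact hr (Subtype.ext (mul_right_cancel₀ ht' (congrArg Subtype.val hrt)))
  refine ((h.comp hm).const_smul (((t : ℝ) : ℝ) : k)).congr fun r => ?_
  have : (((r * t : I) : ℝ) - ((s * t : I) : ℝ) : ℝ) = ((r : ℝ) - s) * t := by
    push_cast
    ring
  simp only [Function.comp_apply]
  rw [this, RCLike.ofReal_mul, mul_inv, smul_smul, mul_left_comm, mul_inv_cancel₀ htk, mul_one]

section Contraction

variable {A : TopAlg.{u} k}

/-- The derivatives of `s ↦ (t ↦ a (s * t))`. -/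
def contractJet (a : SmoothPath A) (n : ℕ) : C(I, C(I, A)) :=
  ContinuousMap.curry ⟨fun p => ((((p.2 : ℝ) : ℝ) : k) ^ n) • SmoothPath.jet A a n (p.1 * p.2), by
    refine Continuous.smul (Continuous.pow ?_ n) ?_
    · exact RCLike.continuous_ofReal.comp (continuous_subtype_val.comp continuous_snd)
    · exact (SmoothPath.jet A a n).continuous.comp (continuous_fst.mul continuous_snd)⟩

theorem continuous_contractJet (n : ℕ) : Continuous fun a : SmoothPath A => contractJet a n := by
  refine ContinuousMap.continuous_of_continuous_uncurry _
    (ContinuousMap.continuous_of_continuous_uncurry _ ?_)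
  refine Continuous.smul (Continuous.pow ?_ n) ?_
  · exact RCLike.continuous_ofReal.comp (continuous_subtype_val.comp continuous_snd)
  · exact ((SmoothPath.continuous_jet n).comp (continuous_fst.comp continuous_fst)).eval
      ((continuous_snd.comp continuous_fst).mul continuous_snd)

/-- By the chain rule the `n`th derivative in `s` of `a (s * t)` is `t ^ n` times the `n`th
derivative of `a` at `s * t`, which is jointly continuous. -/
theorem exists_jet_eq_contractJet (hA : LocConvex A) (a : SmoothPath A) :
    ∃ f : SmoothPath ((contMaps k I).obj A), SmoothPath.jet _ f = contractJet a := by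
  refine SmoothPath.exists_jet_eq (A := (contMaps k I).obj A) (contractJet a)
    fun n t => hasPathDeriv_of_forall hA (contractJet a n) (contractJet a (n + 1))
      (fun s t => ?_) t
  have := (HasPathDeriv.comp_mul (SmoothPath.jet_hasPathDeriv a n (s * t))).smul
    ((((t : ℝ) : ℝ) : k) ^ n)
  rw [smul_smul, ← pow_succ] at this
  exact this

variable (A) in
theorem exists_contract_paths (hA : LocConvex A) :
    ∃ sec : (smoothMaps k).obj A ⟶ (smoothMaps k).obj ((contMaps k I).obj A),
      ∀ (a : SmoothPath A) (s t : I), ContinuousMap.toFun (Y := A)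
        (SmoothPath.incl ((contMaps k I).obj A) (sec.toFun a) s) t = SmoothPath.incl A a (s * t) := by
  choose sec hsec using exists_jet_eq_contractJet hA
  have hap : ∀ (a : SmoothPath A) (s t : I), ContinuousMap.toFun (Y := A)
      (SmoothPath.incl ((contMaps k I).obj A) (sec a) s) t = SmoothPath.incl A a (s * t) :=
    fun a s t => by
      have h := congrArg (fun F : C(I, C(I, A)) => F s t) (congrFun (hsec a) 0)
      refine h.trans ?_
      change ((((t : ℝ) : ℝ) : k) ^ 0) • SmoothPath.jet A a 0 (s * t) = _
      rw [pow_zero, one_smul]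
      rfl
  have hext : ∀ x y : SmoothPath ((contMaps k I).obj A),
      (∀ s t, ContinuousMap.toFun (Y := A) (SmoothPath.incl ((contMaps k I).obj A) x s) t =
        ContinuousMap.toFun (Y := A) (SmoothPath.incl ((contMaps k I).obj A) y s) t) → x = y :=
    fun x y h => SmoothPath.incl_injective (ContinuousMap.ext fun s =>
      ContinuousMap.ext (X := I) (Y := A) (h s))
  refine ⟨{ toFun :=
              { toFun := sec
                map_smul' := fun c x => hext _ _ fun s t => (hap _ s t).trans
                  (congrArg (fun z => c • z) (hap x s t)).symm
                map_zero' := hext _ _ fun s t => hap _ s t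
                map_add' := fun x y => hext _ _ fun s t => (hap _ s t).trans
                  (congrArg₂ (fun z w => z + w) (hap x s t) (hap y s t)).symm
                map_mul' := fun x y => hext _ _ fun s t => (hap _ s t).trans
                  (congrArg₂ (fun z w => z * w) (hap x s t) (hap y s t)).symm }
            cont := SmoothPath.continuous_iff.2 fun n => ?_ }, hap⟩
  exact (continuous_contractJet n).congr fun g => (congrFun (hsec g) n).symm

/-- The contraction `a ↦ (s ↦ (t ↦ a (s * t)))` of the smooth paths starting at `0`. -/
theorem exists_contract (hA : LocConvex A) :
    ∃ sec : (smoothPaths k).ker.obj A ⟶ (smoothPaths k).ker.obj ((contMaps k I).obj A),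
      (∀ a, ((smoothPaths k).ker.map (evalAt 0 A)).toFun (sec.toFun a) = 0) ∧
      sec ≫ (smoothPaths k).ker.map (evalAt 1 A) = 𝟙 _ ∧
      sec ≫ (smoothPaths k).τ.app ((contMaps k I).obj A) =
        (smoothPaths k).ι.app A ≫ (smoothIncl k).app A := by
  obtain ⟨sec, hsec⟩ := exists_contract_paths A hA
  have hz : ∀ a : (smoothPaths k).ker.obj A,
      SmoothPath.incl A (((smoothPaths k).ι.app A).toFun a) 0 = 0 := fun a => a.2
  obtain ⟨ρ, hρ⟩ := ((smoothPaths k).isKer_ι ((contMaps k I).obj A)).exists_lift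
    ((smoothPaths k).ι.app A ≫ sec) fun _ a => ContinuousMap.ext (X := I) (Y := A) fun t => by
      refine (hsec (((smoothPaths k).ι.app A).toFun a) 0 t).trans ?_
      rw [zero_mul, hz]
      rfl
  have hρ' : ∀ (a : (smoothPaths k).ker.obj A) (s t : I), ContinuousMap.toFun (Y := A)
      (SmoothPath.incl ((contMaps k I).obj A)
        (((smoothPaths k).ι.app ((contMaps k I).obj A)).toFun (ρ.toFun a)) s) t =
      SmoothPath.incl A (((smoothPaths k).ι.app A).toFun a) (s * t) := fun a s t => by
    have h := congrArg (fun φ => TopAlg.Hom.toFun φ a) hρ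
    refine Eq.trans ?_ (hsec (((smoothPaths k).ι.app A).toFun a) s t)
    exact congrArg (fun z => ContinuousMap.toFun (Y := A)
      (SmoothPath.incl ((contMaps k I).obj A) z s) t) h
  have hext : ∀ x y : (smoothPaths k).ker.obj A,
      (∀ s, SmoothPath.incl A (((smoothPaths k).ι.app A).toFun x) s =
        SmoothPath.incl A (((smoothPaths k).ι.app A).toFun y) s) → x = y := fun x y h =>
    ((smoothPaths k).isKer_ι A).injective (SmoothPath.incl_injective (ContinuousMap.ext h))
  refine ⟨ρ, fun a => hext _ _ fun s => ?_, TopAlg.hom_ext fun a => hext _ _ fun s => ?_,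
    TopAlg.hom_ext fun a => ContinuousMap.ext (X := I) (Y := A) fun t => ?_⟩
  · refine (hρ' a s 0).trans ?_
    rw [mul_zero, hz]
    rfl
  · refine (hρ' a s 1).trans ?_
    rw [mul_one]
    rfl
  · refine (hρ' a 1 t).trans ?_
    rw [one_mul]
    rfl

end Contraction

/-! ### Smooth homotopy in the general linear group -/

theorem GLMap_comp_eq {A B C : TopAlg.{u} k} {f : A ⟶ B} {g : B ⟶ C} {e : A ⟶ C} (h : f ≫ g = e)
    (x : GLType A) : GLMap g (GLMap f x) = GLMap e x := by
  rw [← h, GLMap_comp]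

theorem GLMap_square {A B B' C : TopAlg.{u} k} {f : A ⟶ B} {g : B ⟶ C} {f' : A ⟶ B'} {g' : B' ⟶ C}
    (h : f ≫ g = f' ≫ g') (x : GLType A) : GLMap g (GLMap f x) = GLMap g' (GLMap f' x) := by
  rw [GLMap_comp_eq h, GLMap_comp]

/-- `x` and `y` lie in the same smooth component of `GL(B)`. -/
def Conn {B : TopAlg.{u} k} (x y : GLType B) : Prop := x⁻¹ * y ∈ (smoothPaths k).null B

namespace Conn

variable {B C : TopAlg.{u} k} {x y z : GLType B}

theorem refl (x : GLType B) : Conn x x := by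
  rw [Conn, inv_mul_cancel]
  exact one_mem _

theorem symm (h : Conn x y) : Conn y x := by
  rw [Conn, ← inv_mem_iff, mul_inv_rev, inv_inv]
  exact h

theorem trans (h : Conn x y) (h' : Conn y z) : Conn x z := by
  have := mul_mem h h'
  rwa [mul_assoc, mul_inv_cancel_left] at this

theorem map (h : Conn x y) (φ : B ⟶ C) : Conn (GLMap φ x) (GLMap φ y) := by
  rw [Conn, ← map_inv, ← map_mul]
  exact (smoothPaths k).map_mem_null φ h

theorem mem_null_iff (h : Conn x y) :
    x ∈ (smoothPaths k).null B ↔ y ∈ (smoothPaths k).null B := by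
  refine ⟨fun hx => ?_, fun hy => ?_⟩
  · have := mul_mem hx h
    rwa [mul_inv_cancel_left] at this
  · have := mul_mem hy h.symm
    rwa [mul_inv_cancel_left] at this

end Conn

/-- Every element of `GL(D^X)` is smoothly homotopic to a constant. -/
def Invariant (X : Type) [TopologicalSpace X] [LocallyCompactSpace X] (D : TopAlg.{u} k) : Prop :=
  ∀ y : GLType ((contMaps k X).obj D), ∃ z, Conn (GLMap (constAt X D) z) y

namespace Invariant

variable {X Y : Type} [TopologicalSpace X] [LocallyCompactSpace X] [TopologicalSpace Y]
  [LocallyCompactSpace Y] {D D' : TopAlg.{u} k}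

/-- Extend along the retraction, deform to a constant there, and restrict back. -/
theorem of_retract (h : Invariant Y D) (i : C(X, Y)) (r : C(Y, X)) (hr : ∀ x, r (i x) = x) :
    Invariant X D := by
  intro y
  obtain ⟨z, hz⟩ := h (GLMap (precomp k r D) y)
  refine ⟨z, ?_⟩
  have := hz.map (precomp k i D)
  rw [GLMap_comp_eq (f := precomp k r D) (g := precomp k i D) (e := 𝟙 _)
    (contMaps_hom_ext fun x => by
      change evalAt (r (i x)) D = evalAt x D
      rw [hr]), GLMap_id] at this
  rwa [GLMap_comp_eq (f := constAt Y D) (g := precomp k i D) (e := constAt X D) rfl] at this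

theorem of_iso (h : Invariant X D) (θ : D ≅ D') : Invariant X D' := by
  intro y
  obtain ⟨z, hz⟩ := h (GLMap ((contMaps k X).map θ.inv) y)
  refine ⟨GLMap θ.hom z, ?_⟩
  have := hz.map ((contMaps k X).map θ.hom)
  rw [GLMap_comp_eq (f := (contMaps k X).map θ.inv) (g := (contMaps k X).map θ.hom) (e := 𝟙 _)
    (by rw [← (contMaps k X).map_comp, θ.inv_hom_id, (contMaps k X).map_id]), GLMap_id] at this
  rwa [GLMap_square (f := constAt X D) (g := (contMaps k X).map θ.hom) (f' := θ.hom)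
    (g' := constAt X D') rfl] at this

theorem of_prod (h : Invariant (Y × X) D) : Invariant Y ((contMaps k X).obj D) := by
  intro y
  obtain ⟨z, hz⟩ := h (GLMap (curryIso X Y D).inv y)
  refine ⟨GLMap (constAt X D) z, ?_⟩
  have := hz.map (curryIso X Y D).hom
  rw [GLMap_comp_eq (curryIso X Y D).inv_hom_id, GLMap_id] at this
  rwa [GLMap_square (f := constAt (Y × X) D) (g := (curryIso X Y D).hom) (f' := constAt X D)
    (g' := constAt Y ((contMaps k X).obj D)) rfl] at this

/-- Evaluating the homotopy at `x` joins the constant `z` to the value of `y` there; if that value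
is null, so are `z` and, with it, `y`. -/
theorem mem_null (h : Invariant X D) (x : X) {y : GLType ((contMaps k X).obj D)}
    (hy : GLMap (evalAt x D) y ∈ (smoothPaths k).null D) :
    y ∈ (smoothPaths k).null ((contMaps k X).obj D) := by
  obtain ⟨z, hz⟩ := h y
  have h1 := hz.map (evalAt x D)
  rw [GLMap_comp_eq (constAt_evalAt x), GLMap_id] at h1
  exact hz.mem_null_iff.1 ((smoothPaths k).map_mem_null _ (h1.mem_null_iff.2 hy))

end Invariant

/-! ### Comparison of smooth and continuous loops -/

/-- The inclusion of the continuous loops into `D^I`. -/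
abbrev loopMaps (D : TopAlg.{u} k) : (contPaths k).loop.obj D ⟶ (contMaps k I).obj D :=
  (contPaths k).loopPaths.app D

/-- The endpoints of the interval. -/
def endpoint : Bool → I
  | false => 0
  | true => 1

theorem isKer_loopMaps (D : TopAlg.{u} k) :
    IsKer (loopMaps D) (fun i => evalAt (endpoint i) D) := by
  have h := (contPaths k).isKer_loopPaths D
  refine ⟨h.emb, fun b i => ?_, fun c hc => h.exists_eq c fun i => ?_⟩
  · cases i
    · exact h.map_eq_zero b false
    · exact h.map_eq_zero b true
  · cases i
    · exact hc false
    · exact hc true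

/-- Smooth loops are continuous. -/
abbrev smoothLoop (D : TopAlg.{u} k) : (smoothPaths k).loop.obj D ⟶ (contPaths k).loop.obj D :=
  (smoothToCont k).loop.app D

theorem loopMaps_smoothLoop {D : TopAlg.{u} k} (a : GLType ((smoothPaths k).loop.obj D)) :
    GLMap (loopMaps D) (GLMap (smoothLoop D) a) =
      GLMap ((smoothPaths k).ι.app D ≫ (smoothIncl k).app D)
        (GLMap ((smoothPaths k).loopIncl.app D) a) :=
  GLMap_square (f := smoothLoop D) (f' := (smoothPaths k).loopIncl.app D) rfl a

theorem commutesWithMaps_smoothLoop : CommutesWithMaps (smoothPaths.{u} k).loop :=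
  PathFunctor.commutesWithMaps_loop commutesWithMaps_smoothMaps

theorem commutesWithMaps_contLoop : CommutesWithMaps (contPaths.{u} k).loop :=
  PathFunctor.commutesWithMaps_loop (commutesWithMaps_contMaps I)

theorem preservesKer_smoothKer : PreservesKer (smoothPaths.{u} k).ker :=
  PathFunctor.preservesKer_ker preservesKer_smoothMaps

theorem preservesKer_contKer : PreservesKer (contPaths.{u} k).ker :=
  PathFunctor.preservesKer_ker (preservesKer_contMaps I)

/-! ### Smooth components of smooth and of continuous loops -/

section Loops

variable {D : TopAlg.{u} k}

theorem smooth_τ_map {B C : TopAlg.{u} k} (φ : B ⟶ C) (x : GLType ((smoothPaths k).ker.obj B)) :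
    GLMap (B := C) ((smoothPaths k).τ.app C) (GLMap ((smoothPaths k).ker.map φ) x) =
      GLMap φ (GLMap (B := B) ((smoothPaths k).τ.app B) x) :=
  GLMap_square ((smoothPaths k).τ.naturality φ) x

/-- Seen in `GL(D^I)`, the loop `b` is null by invariance, so a square `h(s, t)`, smooth in `s`,
joins `1` to `b`. The obstruction to its being a homotopy of loops is its behaviour on the edges `t
= 0` and `t = 1`; the second edge supplies the smooth loop. -/
theorem exists_conn_smoothLoop (hD : LocConvex D) (hI : Invariant I D)
    (b : GLType ((contPaths k).loop.obj D)) :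
    ∃ a, Conn (GLMap (smoothLoop D) a) b := by
  obtain ⟨sec, hsec0, hsec1, hsecτ⟩ := exists_contract hD
  have hk := preservesKer_smoothKer _ _ (isKer_loopMaps D)
  have hb0 : GLMap (evalAt 0 D) (GLMap (loopMaps D) b) = 1 :=
    (isKer_loopMaps D).GLMap_eq_one b false
  have hb1 : GLMap (evalAt 1 D) (GLMap (loopMaps D) b) = 1 :=
    (isKer_loopMaps D).GLMap_eq_one b true
  obtain ⟨h, hh⟩ : GLMap (loopMaps D) b ∈ (smoothPaths k).null ((contMaps k I).obj D) :=
    hI.mem_null 0 (by rw [hb0]; exact one_mem _)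
  have hconst : ∀ (t : I) (x : GLType ((smoothPaths k).ker.obj D)),
      GLMap ((smoothPaths k).ker.map (evalAt t D)) (GLMap ((smoothPaths k).ker.map (constAt I D)) x) =
        x := fun t x => by
    rw [GLMap_comp_eq (e := 𝟙 _) (by rw [← (smoothPaths k).ker.map_comp, constAt_evalAt,
      (smoothPaths k).ker.map_id]), GLMap_id]
  -- Dividing by the edge `t = 0` makes that edge trivial; the end `s = 1` is unchanged because `b`
  -- is `1` at `t = 0`.
  let h' := h * (GLMap ((smoothPaths k).ker.map (constAt I D))
    (GLMap ((smoothPaths k).ker.map (evalAt 0 D)) h))⁻¹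
  have h'0 : GLMap ((smoothPaths k).ker.map (evalAt 0 D)) h' = 1 := by
    simp only [h']
    rw [map_mul, map_inv, hconst, mul_inv_cancel]
  have h'τ : GLMap (B := (contMaps k I).obj D) ((smoothPaths k).τ.app ((contMaps k I).obj D)) h' =
      GLMap (loopMaps D) b := by
    simp only [h']
    rw [map_mul, map_inv, smooth_τ_map, smooth_τ_map, hh, hb0, map_one, inv_one, mul_one]
  -- The edge `t = 1` of `h'` is a smooth path from `1` to the final value of `b`, which is `1`: a
  -- loop.
  obtain ⟨a, ha⟩ := ((smoothPaths k).isKer_loopIncl D).exists_GLMap_eq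
    (GLMap ((smoothPaths k).ker.map (evalAt 1 D)) h')
    fun _ => (smooth_τ_map _ _).trans (by rw [h'τ, hb1])
  -- The square `a(st)` is trivial at `t = 0`, equals `a` on the edge `t = 1`, and equals `a` as a
  -- function of `t` at `s = 1`. So `q` is a smooth path of continuous loops ending at `b a⁻¹`.
  let q := h' * (GLMap sec (GLMap ((smoothPaths k).loopIncl.app D) a))⁻¹
  obtain ⟨q', hq'⟩ := hk.exists_GLMap_eq q fun i => by
    simp only [q]
    cases i
    · change GLMap ((smoothPaths k).ker.map (evalAt 0 D)) _ = 1
      rw [map_mul, map_inv, h'0, GLMap_comp_eq rfl,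
        GLMap_eq_one (φ := sec ≫ (smoothPaths k).ker.map (evalAt 0 D)) hsec0, inv_one, one_mul]
    · change GLMap ((smoothPaths k).ker.map (evalAt 1 D)) _ = 1
      rw [map_mul, map_inv, GLMap_comp_eq hsec1, GLMap_id, ha, mul_inv_cancel]
  refine ⟨a, ?_⟩
  have hmem : b * (GLMap (smoothLoop D) a)⁻¹ ∈ (smoothPaths k).null ((contPaths k).loop.obj D) := by
    refine ⟨q', (isKer_loopMaps D).GLMap_injective ?_⟩
    rw [← smooth_τ_map, hq', map_mul, map_inv, h'τ, GLMap_comp_eq hsecτ,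
      ← loopMaps_smoothLoop, ← map_inv, ← map_mul]
  exact Subgroup.Normal.mem_comm inferInstance hmem

/-- Two squares end at `a` for `s = 1`: the given null homotopy, trivial on the edges `t = 0` and `t
= 1`, and the contraction `a(st)`. Their quotient is a family of smooth loops in `s`, running
continuously from `1` at `t = 0` to `a` at `t = 1`. -/
theorem mem_null_of_smoothLoop (hD : LocConvex D)
    (hS : Invariant I ((smoothPaths k).loop.obj D)) (a : GLType ((smoothPaths k).loop.obj D))
    (ha : GLMap (smoothLoop D) a ∈ (smoothPaths k).null ((contPaths k).loop.obj D)) :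
    a ∈ (smoothPaths k).null ((smoothPaths k).loop.obj D) := by
  obtain ⟨sec, hsec0, hsec1, hsecτ⟩ := exists_contract hD
  obtain ⟨θ, hθ⟩ := commutesWithMaps_smoothLoop.exchange hD I
  have hk := preservesKer_smoothKer _ _ (isKer_loopMaps D)
  obtain ⟨h, hh⟩ := ha
  let y' := (GLMap ((smoothPaths k).ker.map (loopMaps D)) h)⁻¹ *
    GLMap sec (GLMap ((smoothPaths k).loopIncl.app D) a)
  obtain ⟨y, hy⟩ := ((smoothPaths k).isKer_loopIncl ((contMaps k I).obj D)).exists_GLMap_eq y'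
      fun _ => by
    simp only [y']
    change GLMap (B := (contMaps k I).obj D) ((smoothPaths k).τ.app ((contMaps k I).obj D)) _ = 1
    rw [map_mul, map_inv, smooth_τ_map, hh, GLMap_comp_eq hsecτ, loopMaps_smoothLoop, inv_mul_cancel]
  have hev : ∀ t, GLMap ((smoothPaths k).loopIncl.app D)
      (GLMap ((smoothPaths k).loop.map (evalAt t D)) y) =
      GLMap ((smoothPaths k).ker.map (evalAt t D)) y' := fun t => by
    rw [← hy]
    exact GLMap_square ((smoothPaths k).loopIncl.naturality (evalAt t D)) y
  have hinj := ((smoothPaths k).isKer_loopIncl D).GLMap_injective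
  have hy0 : GLMap ((smoothPaths k).loop.map (evalAt 0 D)) y = 1 := hinj <| by
    rw [hev, map_one]
    simp only [y']
    rw [map_mul, map_inv, show GLMap ((smoothPaths k).ker.map (evalAt 0 D))
      (GLMap ((smoothPaths k).ker.map (loopMaps D)) h) = 1 from hk.GLMap_eq_one h false, GLMap_comp_eq (g := (smoothPaths k).ker.map (evalAt 0 D)) rfl,
      GLMap_eq_one (φ := sec ≫ (smoothPaths k).ker.map (evalAt 0 D)) hsec0, inv_one, one_mul]
  have hy1 : GLMap ((smoothPaths k).loop.map (evalAt 1 D)) y = a := hinj <| by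
    rw [hev]
    simp only [y']
    rw [map_mul, map_inv, show GLMap ((smoothPaths k).ker.map (evalAt 1 D))
      (GLMap ((smoothPaths k).ker.map (loopMaps D)) h) = 1 from hk.GLMap_eq_one h true, GLMap_comp_eq hsec1, GLMap_id, inv_one, one_mul]
  -- The quotient is viewed as a continuous path in `GL(Ω_s D)`; invariance of `Ω_s D` on the
  -- interval makes it null as a whole, and so is its value at `1`.
  rw [← hy1, ← hθ 1, GLMap_comp]
  refine (smoothPaths k).map_mem_null _ (hS.mem_null 0 ?_)
  rw [GLMap_comp_eq (hθ 0), hy0]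
  exact one_mem _

/-- `φ` induces a bijection on smooth components of general linear groups. -/
def BijConn {B C : TopAlg.{u} k} (φ : B ⟶ C) : Prop :=
  BijMod ((smoothPaths k).null B) ((smoothPaths k).null C) (GLMap φ)

theorem BijConn.comp {B C E : TopAlg.{u} k} {φ : B ⟶ C} {ψ : C ⟶ E} (hφ : BijConn φ)
    (hψ : BijConn ψ) : BijConn (φ ≫ ψ) := by
  have : GLMap (φ ≫ ψ) = (GLMap ψ).comp (GLMap φ) := MonoidHom.ext fun x => GLMap_comp φ ψ x
  rw [BijConn, this]
  exact BijMod.comp hψ hφ fun y hy => (smoothPaths k).map_mem_null ψ hy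

theorem BijConn.of_iso {B C : TopAlg.{u} k} (θ : B ≅ C) : BijConn θ.hom := by
  refine ⟨fun x hx => ?_, fun y => ⟨GLMap θ.inv y, ?_⟩⟩
  · have := (smoothPaths k).map_mem_null θ.inv hx
    rwa [GLMap_comp_eq θ.hom_inv_id, GLMap_id] at this
  · rw [GLMap_comp_eq θ.inv_hom_id, GLMap_id]
    exact Conn.refl y

theorem BijConn.of_arrow_iso {B C B' C' : TopAlg.{u} k} {φ : B ⟶ C} {ψ : B' ⟶ C'}
    (e : Arrow.mk φ ≅ Arrow.mk ψ) (h : BijConn φ) : BijConn ψ := by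
  have : ψ = (Arrow.leftFunc.mapIso e).inv ≫ φ ≫ (Arrow.rightFunc.mapIso e).hom :=
    Arrow.iso_w' e
  rw [this]
  exact (BijConn.of_iso (Arrow.leftFunc.mapIso e).symm).comp
    (h.comp (BijConn.of_iso (Arrow.rightFunc.mapIso e)))

theorem bijConn_smoothLoop (hD : LocConvex D) (hI : Invariant I D)
    (hS : Invariant I ((smoothPaths k).loop.obj D)) : BijConn (smoothLoop D) :=
  ⟨mem_null_of_smoothLoop hD hS, exists_conn_smoothLoop hD hI⟩

theorem CommutesWithMaps.const_exchange {F : TopAlg.{u} k ⥤ TopAlg.{u} k} {X : Type}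
    [TopologicalSpace X] [LocallyCompactSpace X]
    {θ : F.obj ((contMaps k X).obj D) ⟶ (contMaps k X).obj (F.obj D)}
    (hθ : ∀ x, θ ≫ evalAt x (F.obj D) = F.map (evalAt x D)) :
    F.map (constAt X D) ≫ θ = constAt X (F.obj D) := by
  refine contMaps_hom_ext fun x => ?_
  rw [Category.assoc, hθ, ← F.map_comp, constAt_evalAt, constAt_evalAt, F.map_id]

/-- An element over `(Ω_c D)^X ≅ Ω_c (D^X)` can be deformed to a smooth loop, since `D^X` is
invariant on the interval. As an element over `(Ω_s D)^X` that smooth loop deforms to a constant. -/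
theorem invariant_contLoop {X : Type} [TopologicalSpace X] [LocallyCompactSpace X] [CompactSpace X]
    (hD : LocConvex D) (hS : Invariant X ((smoothPaths k).loop.obj D))
    (hI : Invariant I ((contMaps k X).obj D)) : Invariant X ((contPaths k).loop.obj D) := by
  intro y
  obtain ⟨θ, hθ⟩ := commutesWithMaps_smoothLoop.exchange hD X
  obtain ⟨η, hη⟩ := commutesWithMaps_contLoop.exchange hD X
  obtain ⟨a, ha⟩ := exists_conn_smoothLoop (hD.contMaps X) hI (GLMap η.inv y)
  obtain ⟨z, hz⟩ := hS (GLMap θ.hom a)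
  refine ⟨GLMap (smoothLoop D) z, ?_⟩
  have h1 := hz.map θ.inv
  rw [GLMap_comp_eq θ.hom_inv_id, GLMap_id, ← CommutesWithMaps.const_exchange hθ, GLMap_comp,
    GLMap_comp_eq θ.hom_inv_id, GLMap_id] at h1
  have h2 := ((h1.map (smoothLoop ((contMaps k X).obj D))).trans ha).map η.hom
  rw [GLMap_comp_eq η.inv_hom_id, GLMap_id,
    GLMap_square ((smoothToCont k).loop.naturality (constAt X D)),
    GLMap_comp_eq (CommutesWithMaps.const_exchange hη)] at h2
  exact h2

end Loops

/-! ### Exchange of smooth and continuous loops -/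

theorem contLoop_hom_ext {D E : TopAlg.{u} k} {f g : E ⟶ (contPaths k).loop.obj D}
    (h : ∀ t, f ≫ loopMaps D ≫ evalAt t D = g ≫ loopMaps D ≫ evalAt t D) : f = g :=
  (isKer_loopMaps D).hom_ext (contMaps_hom_ext fun t => by
    rw [Category.assoc, Category.assoc, h])

theorem CommutesWithMaps.exchange_contLoop {F : TopAlg.{u} k ⥤ TopAlg.{u} k}
    (hF : CommutesWithMaps F) {D : TopAlg.{u} k} (hD : LocConvex D) :
    ∃ θ : F.obj ((contPaths k).loop.obj D) ≅ (contPaths k).loop.obj (F.obj D),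
      ∀ t, θ.hom ≫ loopMaps (F.obj D) ≫ evalAt t (F.obj D) =
        F.map (loopMaps D) ≫ F.map (evalAt t D) := by
  obtain ⟨θ, hθ⟩ := hF.exchange hD I
  obtain ⟨θ', hθ'⟩ := (hF.preservesKer _ _ (isKer_loopMaps D)).exists_iso
    (isKer_loopMaps (F.obj D)) θ fun c => forall_congr' fun i => by
      rw [← hθ]
      rfl
  exact ⟨θ', fun t => by rw [← Category.assoc, hθ', Category.assoc, hθ]⟩

/-- Both inclusions compare a loop in one variable while carrying the other along as a continuous
loop; exchanging the variables matches them, as is checked at each `t`. -/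
theorem arrowIso_smoothLoop_contLoop {D : TopAlg.{u} k} (hD : LocConvex D) :
    Nonempty (Arrow.mk (smoothLoop ((contPaths k).loop.obj D)) ≅
      Arrow.mk ((contPaths k).loop.map (smoothLoop D))) := by
  obtain ⟨θ, hθ⟩ := commutesWithMaps_smoothLoop.exchange_contLoop hD
  obtain ⟨η, hη⟩ := commutesWithMaps_contLoop.exchange_contLoop hD
  refine ⟨Arrow.isoMk θ η (contLoop_hom_ext fun t => ?_)⟩
  have nat : ∀ {B C : TopAlg.{u} k} (φ : B ⟶ C), (contPaths k).loop.map φ ≫ loopMaps C =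
      loopMaps B ≫ (contMaps k I).map φ := fun φ => (contPaths k).loopPaths.naturality φ
  have nat' : ∀ {B C : TopAlg.{u} k} (φ : B ⟶ C), (smoothPaths k).loop.map φ ≫ smoothLoop C =
      smoothLoop B ≫ (contPaths k).loop.map φ := fun φ => (smoothToCont k).loop.naturality φ
  change (θ.hom ≫ (contPaths k).loop.map (smoothLoop D)) ≫ _ = (smoothLoop _ ≫ η.hom) ≫ _
  calc (θ.hom ≫ (contPaths k).loop.map (smoothLoop D)) ≫ loopMaps _ ≫ evalAt t _
      = θ.hom ≫ ((contPaths k).loop.map (smoothLoop D) ≫ loopMaps _) ≫ evalAt t _ := by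
        simp only [Category.assoc]
    _ = (θ.hom ≫ loopMaps _ ≫ evalAt t _) ≫ smoothLoop D := by
        rw [nat, Category.assoc, map_evalAt]
        simp only [Category.assoc]
    _ = (smoothPaths k).loop.map (loopMaps D) ≫ (smoothPaths k).loop.map (evalAt t D) ≫
          smoothLoop D := by rw [hθ, Category.assoc]
    _ = smoothLoop _ ≫ (contPaths k).loop.map (loopMaps D) ≫
          (contPaths k).loop.map (evalAt t D) := by
        rw [nat', ← Category.assoc, nat', Category.assoc]
    _ = (smoothLoop _ ≫ η.hom) ≫ loopMaps _ ≫ evalAt t _ := by rw [← hη, Category.assoc]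

theorem locConvex_contLoopIter {D : TopAlg.{u} k} (hD : LocConvex D) (n : ℕ) :
    LocConvex (((contPaths k).loopIter n).obj D) :=
  (PathFunctor.commutesWithMaps_loopIter (commutesWithMaps_contMaps I) n).locConvex hD

theorem locConvex_smoothLoopIter {D : TopAlg.{u} k} (hD : LocConvex D) (n : ℕ) :
    LocConvex (((smoothPaths k).loopIter n).obj D) :=
  (PathFunctor.commutesWithMaps_loopIter commutesWithMaps_smoothMaps n).locConvex hD

theorem arrowIso_smoothLoop_contLoopIter {D : TopAlg.{u} k} (hD : LocConvex D) (n : ℕ) :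
    Nonempty (Arrow.mk (smoothLoop (((contPaths k).loopIter n).obj D)) ≅
      Arrow.mk (((contPaths k).loopIter n).map (smoothLoop D))) := by
  induction n with
  | zero => exact ⟨Iso.refl _⟩
  | succ n ih =>
    obtain ⟨e⟩ := ih
    obtain ⟨e'⟩ := arrowIso_smoothLoop_contLoop (locConvex_contLoopIter hD n)
    exact ⟨e' ≪≫ (contPaths k).loop.mapArrow.mapIso e⟩

/-- By definition the new loop is the outermost one; the replacement of loops needs it innermost. -/
theorem PathFunctor.loopIter_succ' (P : PathFunctor.{u} k) (n : ℕ) :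
    P.loopIter (n + 1) = P.loop ⋙ P.loopIter n := by
  induction n with
  | zero => rfl
  | succ n ih => exact congrArg (· ⋙ P.loop) ih

/-! ### Homotopy invariance on cubes -/

section Cubes

variable {n : ℕ}

/-- The endomorphism of the cube which sets the coordinates in `T` to `0`. -/
def eraseCoords (T : Finset (Fin n)) : C(Fin n → I, Fin n → I) :=
  ⟨fun t l => if l ∈ T then 0 else t l, by
    refine continuous_pi fun l => ?_
    split_ifs
    · exact continuous_const
    · exact continuous_apply l⟩

theorem eraseCoords_apply (T : Finset (Fin n)) (t : Fin n → I) (l : Fin n) :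
    eraseCoords T t l = if l ∈ T then 0 else t l := rfl

/-- Permutation of the coordinates of the cube. -/
def permCoords (e : Fin n ≃ Fin n) : C(Fin n → I, Fin n → I) := ⟨fun t l => t (e l), by fun_prop⟩

variable {D : TopAlg.{u} k}

theorem precomp_precomp {X Y Z : Type} [TopologicalSpace X] [LocallyCompactSpace X]
    [TopologicalSpace Y] [LocallyCompactSpace Y] [TopologicalSpace Z] [LocallyCompactSpace Z]
    (p : C(Y, Z)) (q : C(X, Y)) {r : C(X, Z)} (h : ∀ x, p (q x) = r x)
    (y : GLType ((contMaps k Z).obj D)) :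
    GLMap (precomp k q D) (GLMap (precomp k p D) y) = GLMap (precomp k r D) y := by
  obtain rfl : p.comp q = r := ContinuousMap.ext h
  exact GLMap_comp_eq rfl y

/-- If the elements of `GL(D^{I^{m+2}})` do not depend, up to smooth homotopy, on the last two
coordinates, then they do not depend on any coordinate. -/
theorem invariant_cube {m : ℕ} {p : C(Fin (m + 2) → I, Fin m → I)}
    (hp : ∀ t j, p t j = t (Fin.castAdd 2 j))
    (h : ∀ y : GLType ((contMaps k (Fin (m + 2) → I)).obj D),
      ∃ z, Conn (GLMap (precomp k p D) z) y) : Invariant (Fin (m + 2) → I) D := by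
  -- Swapping `j` with the last coordinate, applying the hypothesis and swapping back deforms `y` to
  -- a map independent of `j`; setting that coordinate to `0` does not change the latter.
  have one : ∀ j y, Conn (GLMap (precomp k (eraseCoords {j}) D) y) y := fun j y => by
    let e := permCoords (Equiv.swap j (Fin.last (m + 1)))
    have hee : ∀ t, e (e t) = t := fun t => funext fun l =>
      congrArg t (Equiv.swap_apply_self _ _ l)
    obtain ⟨z, hz⟩ := h (GLMap (precomp k e D) y)
    have h1 := hz.map (precomp k e D)
    rw [precomp_precomp e e (r := ContinuousMap.id _) hee] at h1
    have hy : GLMap (precomp k (ContinuousMap.id (Fin (m + 2) → I)) D) y = y := GLMap_id _ y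
    rw [hy] at h1
    have h2 := h1.map (precomp k (eraseCoords {j}) D)
    rw [precomp_precomp p e (r := p.comp e) (fun _ => rfl)] at h1 h2
    rw [precomp_precomp (p.comp e) (eraseCoords {j}) (r := p.comp e) fun t => funext fun l => ?_]
      at h2
    · exact h2.symm.trans h1
    · have hl : Fin.castAdd 2 l ≠ Fin.last (m + 1) := Fin.ne_of_lt (by
        rw [Fin.lt_def, Fin.val_castAdd, Fin.val_last]
        omega)
      rw [ContinuousMap.comp_apply, ContinuousMap.comp_apply, hp, hp]
      change eraseCoords {j} t (Equiv.swap j _ _) = t (Equiv.swap j _ _)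
      rw [eraseCoords_apply, if_neg]
      rw [Finset.mem_singleton, Equiv.swap_apply_eq_iff, Equiv.swap_apply_left]
      exact hl
  have all : ∀ (T : Finset (Fin (m + 2))) y, Conn (GLMap (precomp k (eraseCoords T) D) y) y :=
      fun T => by
    induction T using Finset.induction_on with
    | empty =>
      intro y
      have : GLMap (precomp k (eraseCoords ∅) D) y = y :=
        (congrArg (fun φ => GLMap φ y) (contMaps_hom_ext fun x => by
          change evalAt (eraseCoords ∅ x) D = evalAt x D
          congr 1)).trans (GLMap_id _ y)
      rw [this]
      exact Conn.refl y
    | insert j T _ ih =>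
      intro y
      have := (ih (GLMap (precomp k (eraseCoords {j}) D) y)).trans (one j y)
      rwa [precomp_precomp (eraseCoords {j}) (eraseCoords T) (r := eraseCoords (insert j T))
        fun t => funext fun l => by
          simp only [eraseCoords_apply, Finset.mem_singleton, Finset.mem_insert]
          split_ifs <;> tauto] at this
  intro y
  refine ⟨GLMap (evalAt 0 D) y, ?_⟩
  have := all Finset.univ y
  rwa [← GLMap_comp_eq (f := evalAt 0 D) (g := constAt (Fin (m + 2) → I) D)
    (contMaps_hom_ext fun x => by
      change evalAt 0 D = evalAt (eraseCoords Finset.univ x) D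
      congr 1
      funext l
      rw [eraseCoords_apply, if_pos (Finset.mem_univ l)]
      rfl)] at this

/-- `I^n` as a retract of `I^n × I`. -/
theorem Invariant.cube_succ (h : Invariant (Fin (n + 1) → I) D) :
    Invariant (I × (Fin n → I)) D :=
  h.of_retract ⟨fun p => Fin.cons p.1 p.2, by fun_prop⟩
    ⟨fun t => (t 0, fun j => t j.succ), by fun_prop⟩ fun x => by simp

theorem Invariant.interval (h : Invariant (Fin (n + 1) → I) D) : Invariant I D :=
  h.of_retract ⟨fun s _ => s, by fun_prop⟩ ⟨fun t => t 0, by fun_prop⟩ fun _ => rfl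

theorem Invariant.cube_one (h : Invariant I D) : Invariant (Fin 1 → I) D :=
  h.of_retract ⟨fun t => t 0, by fun_prop⟩ ⟨fun s _ => s, by fun_prop⟩ fun x =>
    funext fun j => by
      rw [Subsingleton.elim j 0]
      rfl

end Cubes

/-! ### The comparison theorem -/

section Comparison

variable {A : TopAlg.{u} k}

/-- Induction on the number of continuous loops, trading the outermost one for a smooth one; each
loop uses up one coordinate of the cube. -/
theorem invariant_loopIter (hA : LocConvex A) {i : ℕ}
    (h : ∀ b ≤ i, Invariant (Fin (i + 1 - b) → I) (((smoothPaths k).loopIter b).obj A)) (a : ℕ) :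
    ∀ b, a + b ≤ i → Invariant (Fin (i + 1 - (a + b)) → I)
      (((contPaths k).loopIter a).obj (((smoothPaths k).loopIter b).obj A)) := by
  induction a with
  | zero =>
    intro b hb
    rw [zero_add] at hb ⊢
    exact h b hb
  | succ a ih =>
    intro b hb
    have hD := locConvex_contLoopIter (locConvex_smoothLoopIter hA b) a
    obtain ⟨e⟩ := arrowIso_smoothLoop_contLoopIter (locConvex_smoothLoopIter hA b) a
    have h1 := ih (b + 1) (by omega)
    have h2 := ih b (by omega)
    rw [show i + 1 - (a + b) = i + 1 - (a + 1 + b) + 1 by omega] at h2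
    rw [show a + (b + 1) = a + 1 + b by omega] at h1
    -- With `D = Ω_c^a Ω_s^b A`, the algebra `Ω_s D` is `Ω_c^a Ω_s^{b+1} A` after exchange. The
    -- extra coordinate in `h2` plays the role of the interval for maps from the smaller cube to
    -- `D`.
    exact invariant_contLoop hD (h1.of_iso (Arrow.leftFunc.mapIso e).symm) h2.cube_succ.of_prod

/-- After exchange this is `smoothLoop` for `D = Ω_c^a Ω_s^b A`. Since `a + b + 1 ≤ i`, at least one
coordinate remains both for `D` and for `Ω_s D`. -/
theorem bijConn_contLoopIter_map_smoothLoop (hA : LocConvex A) {i : ℕ}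
    (h : ∀ b ≤ i, Invariant (Fin (i + 1 - b) → I) (((smoothPaths k).loopIter b).obj A)) (a b : ℕ)
    (hab : a + b + 1 ≤ i) :
    BijConn (((contPaths k).loopIter a).map (smoothLoop (((smoothPaths k).loopIter b).obj A))) := by
  have hD := locConvex_contLoopIter (locConvex_smoothLoopIter hA b) a
  obtain ⟨e⟩ := arrowIso_smoothLoop_contLoopIter (locConvex_smoothLoopIter hA b) a
  have h1 := invariant_loopIter hA h a b (by omega)
  have h2 := invariant_loopIter hA h a (b + 1) (by omega)
  rw [show i + 1 - (a + b) = i - (a + b) + 1 by omega] at h1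
  rw [show i + 1 - (a + (b + 1)) = i - (a + b + 1) + 1 by omega] at h2
  exact (bijConn_smoothLoop hD h1.interval
    (h2.interval.of_iso (Arrow.leftFunc.mapIso e).symm)).of_arrow_iso e

/-- The map factors through `Ω_c^{a+1} Ω_s^n A`: the outermost smooth loop is made continuous, then
the induction applies with `a + 1` continuous loops outside. -/
theorem bijConn_contLoopIter_map_loopIter (hA : LocConvex A) {i : ℕ}
    (h : ∀ b ≤ i, Invariant (Fin (i + 1 - b) → I) (((smoothPaths k).loopIter b).obj A)) (n : ℕ) :
    ∀ a, a + n ≤ i →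
      BijConn (((contPaths k).loopIter a).map (((smoothToCont k).loopIter n).app A)) := by
  induction n with
  | zero =>
    intro a _
    have := BijConn.of_iso (Iso.refl (((contPaths k).loopIter a).obj A))
    rwa [Iso.refl_hom, ← ((contPaths k).loopIter a).map_id] at this
  | succ n ih =>
    intro a ha
    have h1 := ih (a + 1) (by omega)
    rw [(contPaths k).loopIter_succ'] at h1
    have e := ((contPaths k).loopIter a).map_comp (smoothLoop (((smoothPaths k).loopIter n).obj A))
      ((contPaths k).loop.map (((smoothToCont k).loopIter n).app A))
    exact (congrArg BijConn e).mpr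
      ((bijConn_contLoopIter_map_smoothLoop hA h a n (by omega)).comp h1)

theorem null_smooth_le_cont (D : TopAlg.{u} k) :
    (smoothPaths k).null D ≤ (contPaths k).null D := by
  rintro _ ⟨y, rfl⟩
  exact ⟨GLMap ((smoothToCont k).ker.app D) y, GLMap_comp_eq ((smoothToCont k).ker_τ D) y⟩

/-- A continuous path from `1` is an element of `GL(D^I)` with value `1` at `0`; invariance makes it
smoothly null, and so is its endpoint. -/
theorem null_cont_le_smooth {D : TopAlg.{u} k} (hI : Invariant I D) :
    (contPaths k).null D ≤ (smoothPaths k).null D := by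
  rintro _ ⟨y, rfl⟩
  have h0 : GLMap (evalAt 0 D) (GLMap ((contPaths k).ι.app D) y) = 1 :=
    ((contPaths k).isKer_ι D).GLMap_eq_one y ()
  have h1 : GLMap (evalAt 1 D) (GLMap ((contPaths k).ι.app D) y) =
      GLMap (B := D) ((contPaths k).τ.app D) y := GLMap_comp_eq rfl y
  change GLMap (B := D) ((contPaths k).τ.app D) y ∈ _
  rw [← h1]
  exact (smoothPaths k).map_mem_null (evalAt 1 D) (hI.mem_null 0 (by rw [h0]; exact one_mem _))

/-- Carries surjectivity on components through the exchange isomorphisms, from loops in mapping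
algebras to maps into the loop algebra. -/
theorem exists_conn_precomp_smoothLoopIter (hA : LocConvex A) {b : ℕ} {X : Type}
    [TopologicalSpace X] [LocallyCompactSpace X] [CompactSpace X] {Y : Type} [TopologicalSpace Y]
    [LocallyCompactSpace Y] [CompactSpace Y] (p : C(X, Y))
    (h : ∀ y, ∃ x, Conn (GLMap (((smoothPaths k).loopIter b).map (precomp k p A)) x) y)
    (y : GLType ((contMaps k X).obj (((smoothPaths k).loopIter b).obj A))) :
    ∃ z, Conn (GLMap (precomp k p (((smoothPaths k).loopIter b).obj A)) z) y := by
  have hF := PathFunctor.commutesWithMaps_loopIter (P := smoothPaths.{u} k)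
    commutesWithMaps_smoothMaps b
  obtain ⟨θ, hθ⟩ := hF.exchange hA X
  obtain ⟨η, hη⟩ := hF.exchange hA Y
  obtain ⟨x, hx⟩ := h (GLMap θ.inv y)
  refine ⟨GLMap η.hom x, ?_⟩
  have h1 := hx.map θ.hom
  rw [GLMap_comp_eq θ.inv_hom_id, GLMap_id] at h1
  rwa [GLMap_square (f := ((smoothPaths k).loopIter b).map (precomp k p A)) (g := θ.hom)
    (f' := η.hom) (g' := precomp k p _) (contMaps_hom_ext fun x => by
      rw [Category.assoc, hθ, ← Functor.map_comp]
      exact (hη (p x)).symm)] at h1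

end Comparison

end SmoothK

end

/-- Let `A` be a complete Hausdorff locally convex `k`-algebra and `i ≥ 0`. If
`K^{sm}_{i+1}(A) → K^{sm}_{i+1}(A^I)` and `K^{sm}_j(A^{I^{i-j}}) → K^{sm}_j(A^{I^{i-j+2}})`,
`0 ≤ j ≤ i`, are isomorphisms, then so is `β_{i+1} : K^{sm}_{i+1}(A) → K^{top}_{i+1}(A)`. -/
theorem theorem1p13 (k : Type) [RCLike k] (A : Type u) [NonUnitalRing A] [Module k A]
    [IsScalarTower k A A] [SMulCommClass k A A] [UniformSpace A] [IsUniformAddGroup A]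
    [IsTopologicalRing A] [ContinuousSMul k A] [T2Space A] [CompleteSpace A]
    [PolynormableSpace k A] (i : ℕ)
    (h₁ : IsIso ((SmoothK.Ksm k (i + 1)).map ((SmoothK.constMaps k I).app (SmoothK.TopAlg.of k A))))
    (h₂ : ∀ j : ℕ, j ≤ i →
      IsIso ((SmoothK.Ksm k j).map (SmoothK.cubeIncl k (i - j) (SmoothK.TopAlg.of k A)))) :
    IsIso ((SmoothK.beta k (i + 1)).app (SmoothK.TopAlg.of k A)) := by
  have hA := SmoothK.locConvex_of_polynormable (k := k) A
  have h : ∀ b ≤ i, SmoothK.Invariant (Fin (i + 1 - b) → I)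
      (((SmoothK.smoothPaths k).loopIter b).obj (SmoothK.TopAlg.of k A)) := by
    intro b hb
    -- For `b = i` the cube is one-dimensional and the first hypothesis applies, `K^{sm}_{i+1}`
    -- being the components of `GL(Ω_s^i A)`. Surjectivity is all that is needed.
    rcases hb.eq_or_lt with rfl | hb
    · rw [Nat.add_sub_cancel_left]
      refine SmoothK.Invariant.cube_one fun y => ?_
      have hF := SmoothK.PathFunctor.commutesWithMaps_loopIter (P := SmoothK.smoothPaths.{u} k)
        SmoothK.commutesWithMaps_smoothMaps b
      obtain ⟨θ, hθ⟩ := hF.exchange hA I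
      obtain ⟨x, hx⟩ := ((SmoothK.PathFunctor.isIso_KPath_map_iff SmoothK.preservesKer_smoothKer b
        (SmoothK.constAt I (SmoothK.TopAlg.of k A))).1 h₁).2 (SmoothK.GLMap θ.inv y)
      refine ⟨x, ?_⟩
      have h3 := SmoothK.Conn.map hx θ.hom
      rwa [SmoothK.GLMap_comp_eq θ.inv_hom_id, SmoothK.GLMap_id,
        SmoothK.GLMap_comp_eq (SmoothK.CommutesWithMaps.const_exchange hθ)] at h3
    · obtain ⟨m, rfl⟩ := Nat.exists_eq_add_of_lt hb
      -- `K^{sm}_{b+1}` lives on `Ω_s^b`, so `j = b + 1`. With `m = i - b - 1` the target cube has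
      -- dimension `m + 2 = i + 1 - b`.
      have h3 := h₂ (b + 1) (by omega)
      rw [show b + m + 1 - (b + 1) = m by omega] at h3
      rw [show b + m + 1 + 1 - b = m + 2 by omega]
      exact SmoothK.invariant_cube (fun _ _ => rfl)
        (SmoothK.exists_conn_precomp_smoothLoopIter hA _
          ((SmoothK.PathFunctor.isIso_KPath_map_iff SmoothK.preservesKer_smoothKer b _).1 h3).2)
  refine (SmoothK.PathFunctor.isIso_whiskerRight_π_iff (SmoothK.smoothToCont k)
    SmoothK.preservesKer_smoothKer SmoothK.preservesKer_contKer i _).2 ?_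
  have hbij := SmoothK.bijConn_contLoopIter_map_loopIter hA h i 0 (by omega)
  have hI := SmoothK.invariant_loopIter hA h i 0 (by omega)
  rw [add_zero, Nat.add_sub_cancel_left] at hI
  -- The bijection concerns smooth components on both sides; the remaining one-dimensional
  -- invariance of `Ω_c^i A` converts continuously null elements of the target into smoothly null
  -- ones.
  exact ⟨fun x hx => hbij.1 x (SmoothK.null_cont_le_smooth hI.interval hx), fun y =>
    (hbij.2 y).imp fun x hx => SmoothK.null_smooth_le_cont _ hx⟩
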